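/- Let $F$ be a field of characteristic $2$, write $F^2=\{x^2 : x\in F\}$, and let $Q$ be an $F$-quaternion division algebra, i.e. a division algebra with centre $F$ and $\dim_F Q=4$. An $F$-involution on $Q$ is an $F$-linear map $\theta:Q\to Q$ with $\theta(xy)=\theta(y)\theta(x)$ and $\theta^2=\mathrm{id}$; put $\mathrm{Alt}(Q,\theta)=\{a-\theta(a) : a\in Q\}$. A hermitian form over $(Q,\theta)$ is a finite-dimensional right $Q$-vector space $V$ with a bi-additive map $h:V\times V\to Q$ such that $h(xd_1,yd_2)=\theta(d_1)h(x,y)d_2$ and $h(y,x)=\theta(h(x,y))$ for all $x,y\in V$ and $d_1,d_2\in Q$; it is anisotropic if $h(x,x)\neq 0$ for all $x\neq 0$, and nondegenerate if only $x=0$ satisfies $h(x,y)=0$ for all $y\in V$. A quadratic form over $(Q,\theta)$ is a finite-dimensional right $Q$-vector space $V$ with a map $q:V\to Q/\mathrm{Alt}(Q,\theta)$ such that $q(xd)=\theta(d)q(x)d$ for all $x\in V$, $d\in Q$, and such that there is a (necessarily unique) hermitian form $h$ over $(Q,\theta)$ on $V$, the polar form of $q$, with $q(x+y)-q(x)-q(y)=h(x,y)+\mathrm{Alt}(Q,\theta)$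 for all $x,y\in V$; it is anisotropic if $q(x)\neq 0$ for all $x\neq 0$, and nonsingular if its polar form is nondegenerate. Let $u^+(Q)$, $u(Q)$ and $\widetilde u(Q)$ be the suprema of the dimensions $\dim_Q V$ of, respectively, the anisotropic hermitian forms, the anisotropic quadratic forms, and the anisotropic nonsingular quadratic forms over $(Q,\theta)$. Suppose that $[F:F^2]=2$. Then $F$-involutions on $Q$ exist, and for every choice of the $F$-involution $\theta$ in these definitions $$u^+(Q)=2\qquad\text{and}\qquad u(Q)=\widetilde u(Q)=3 .$$ This applies in particular to local fields of characteristic $2$: if $F\simeq\mathbb F_{2^n}((t))$ for some $n\geq 1$, then $[F:F^2]=2$, and hence the conclusion holds for every $F$-quaternion division algebra $Q$. -/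

import Mathlib

namespace GenQuad

universe u v w

section Algebras

variable (F : Type u) (A : Type v) [Field F] [Ring A] [Algebra F A]

/-- An `F`-linear involution (involution of the first kind) on the `F`-algebra `A`. -/
structure Involution extends A →ₗ[F] A where
  map_mul' : ∀ x y : A, toFun (x * y) = toFun y * toFun x
  involutive' : ∀ x : A, toFun (toFun x) = x

/-- An `F`-quaternion algebra: a central simple `F`-algebra of degree `2`. -/
structure IsQuaternionAlgebra : Prop where
  isCentral : Algebra.IsCentral F A
  isSimple : IsSimpleRing A
  finrank_eq : Module.finrank F A = 2 ^ 2

end Algebras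

/-- The degree `[F : F²]` is `n`, for a field `F` of characteristic `2`; here `F²` is the subfield
of squares, the image of the Frobenius map `x ↦ x ^ 2`. The natural number `n` is meant to be
positive, so that the extension is finite. -/
def DegreeOverSquaresEq (F : Type u) [Field F] [CharP F 2] (n : ℕ) : Prop :=
  Module.finrank (frobenius F 2).fieldRange F = n

/-- A local field of characteristic `2`: a field isomorphic to the field of Laurent series in one
variable over the field with `2 ^ n` elements, for some `n ≥ 1`. -/
def IsLocalFieldCharTwo (F : Type u) [Field F] : Prop :=
  ∃ n : ℕ, 1 ≤ n ∧ Nonempty (F ≃+* LaurentSeries (GaloisField 2 n))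

section Forms

variable {F : Type u} {D : Type v} [Field F] [DivisionRing D] [Algebra F D]

namespace Involution

/-- `Alt(D, θ) = {a - θ(a) | a ∈ D}`. -/
def alt (θ : Involution F D) : Submodule F D :=
  LinearMap.range ((LinearMap.id : D →ₗ[F] D) - θ.toLinearMap)

/-- The map `a ↦ θ(d) a d` on `D`. -/
def sandwich (θ : Involution F D) (d : D) : D →ₗ[F] D :=
  (LinearMap.mulLeft F (θ.toLinearMap d)).comp (LinearMap.mulRight F d)

theorem sandwich_mem_alt (θ : Involution F D) (d : D) :
    θ.alt ≤ θ.alt.comap (θ.sandwich d) := by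
  rintro _ ⟨a, rfl⟩
  refine ⟨θ.sandwich d a, ?_⟩
  have h1 : ∀ x y : D, θ.toLinearMap (x * y) = θ.toLinearMap y * θ.toLinearMap x := θ.map_mul'
  have h2 : ∀ x : D, θ.toLinearMap (θ.toLinearMap x) = x := θ.involutive'
  simp [sandwich, h1, h2, sub_mul, mul_sub, mul_assoc]

/-- The map `a + Alt(D, θ) ↦ θ(d) a d + Alt(D, θ)` on `D / Alt(D, θ)`. -/
def quotSandwich (θ : Involution F D) (d : D) : (D ⧸ θ.alt) →ₗ[F] (D ⧸ θ.alt) :=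
  θ.alt.mapQ θ.alt (θ.sandwich d) (θ.sandwich_mem_alt d)

end Involution

/-- A hermitian form over `(D, θ)` on the right `D`-vector space `V`; right vector spaces are
modules over the opposite ring, so that `x d` is written `MulOpposite.op d • x`. -/
structure HermitianForm (θ : Involution F D) (V : Type w) [AddCommGroup V] [Module Dᵐᵒᵖ V] where
  toFun : V → V → D
  add_left : ∀ x x' y : V, toFun (x + x') y = toFun x y + toFun x' y
  add_right : ∀ x y y' : V, toFun x (y + y') = toFun x y + toFun x y'
  smul_smul : ∀ (x y : V) (d₁ d₂ : D),
    toFun (MulOpposite.op d₁ • x) (MulOpposite.op d₂ • y) = θ.toFun d₁ * toFun x y * d₂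
  symm : ∀ x y : V, toFun y x = θ.toFun (toFun x y)

namespace HermitianForm

variable {θ : Involution F D} {V : Type w} [AddCommGroup V] [Module Dᵐᵒᵖ V]

/-- The radical of the form is zero. -/
def Nondegenerate (h : HermitianForm θ V) : Prop :=
  ∀ x : V, (∀ y : V, h.toFun x y = 0) → x = 0

/-- The form does not represent `0`. -/
def Anisotropic (h : HermitianForm θ V) : Prop :=
  ∀ x : V, x ≠ 0 → h.toFun x x ≠ 0

end HermitianForm

/-- A (generalised) quadratic form over `(D, θ)` on the right `D`-vector space `V`, together with
its polar form, which is uniquely determined by the map `q` (see `QuadForm.polar_unique`). -/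
structure QuadForm (θ : Involution F D) (V : Type w) [AddCommGroup V] [Module Dᵐᵒᵖ V] where
  toFun : V → D ⧸ θ.alt
  polar : HermitianForm θ V
  map_smul : ∀ (x : V) (d : D), toFun (MulOpposite.op d • x) = θ.quotSandwich d (toFun x)
  map_add : ∀ x y : V,
    toFun (x + y) - toFun x - toFun y = Submodule.Quotient.mk (p := θ.alt) (polar.toFun x y)

namespace QuadForm

variable {θ : Involution F D} {V : Type w} [AddCommGroup V] [Module Dᵐᵒᵖ V]

/-- The polar form is nondegenerate. -/
def Nonsingular (q : QuadForm θ V) : Prop := q.polar.Nondegenerate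

/-- The form does not represent `0`, that is, `q(x)` is nonzero in `D / Alt(D, θ)` for `x ≠ 0`. -/
def Anisotropic (q : QuadForm θ V) : Prop :=
  ∀ x : V, x ≠ 0 → q.toFun x ≠ 0

/-- The polar form is determined by the quadratic map. -/
theorem polar_unique [FiniteDimensional F D] (q q' : QuadForm θ V) (hq : q.toFun = q'.toFun)
    (x y : V) : q.polar.toFun x y = q'.polar.toFun x y := by
  have h1 : ∀ a b : D, θ.toLinearMap (a * b) = θ.toLinearMap b * θ.toLinearMap a := θ.map_mul'
  have h2 : ∀ a : D, θ.toLinearMap (θ.toLinearMap a) = a := θ.involutive'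
  have hone : θ.toLinearMap 1 = 1 := by
    have h := h1 (θ.toLinearMap 1) 1
    rw [mul_one, h2, mul_one] at h
    exact h.symm
  by_contra hne
  have hmem : ∀ d : D, (q.polar.toFun x y - q'.polar.toFun x y) * d ∈ θ.alt := by
    intro d
    have e := q.map_add x (MulOpposite.op d • y)
    rw [hq, q'.map_add, Submodule.Quotient.eq] at e
    have e1 := q.polar.smul_smul x y 1 d
    have e2 := q'.polar.smul_smul x y 1 d
    have hone' : θ.toFun 1 = 1 := hone
    rw [MulOpposite.op_one, one_smul, hone', one_mul] at e1 e2
    rw [e1, e2] at e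
    have := θ.alt.neg_mem e
    rwa [neg_sub, ← sub_mul] at this
  have htop : Function.Surjective ((LinearMap.id : D →ₗ[F] D) - θ.toLinearMap) := by
    intro a
    have := hmem ((q.polar.toFun x y - q'.polar.toFun x y)⁻¹ * a)
    rwa [mul_inv_cancel_left₀ (sub_ne_zero.mpr hne)] at this
  have hinj := LinearMap.injective_iff_surjective.mpr htop
  have : (1 : D) = 0 := hinj (by simp [hone])
  exact one_ne_zero this

end QuadForm

/-- `u⁺`: the supremum of the dimensions of the anisotropic hermitian forms over `(D, θ)`. -/
noncomputable def uPlus (θ : Involution F D) : ℕ∞ :=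
  sSup {n : ℕ∞ | ∃ (V : Type v) (_ : AddCommGroup V) (_ : Module Dᵐᵒᵖ V)
    (_ : Module.Finite Dᵐᵒᵖ V) (h : HermitianForm θ V),
    h.Anisotropic ∧ n = (Module.finrank Dᵐᵒᵖ V : ℕ∞)}

/-- `u`: the supremum of the dimensions of the anisotropic quadratic forms over `(D, θ)`. -/
noncomputable def uQuad (θ : Involution F D) : ℕ∞ :=
  sSup {n : ℕ∞ | ∃ (V : Type v) (_ : AddCommGroup V) (_ : Module Dᵐᵒᵖ V)
    (_ : Module.Finite Dᵐᵒᵖ V) (q : QuadForm θ V),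
    q.Anisotropic ∧ n = (Module.finrank Dᵐᵒᵖ V : ℕ∞)}

/-- `ũ`: the supremum of the dimensions of the anisotropic nonsingular quadratic forms over
`(D, θ)`. -/
noncomputable def uTilde (θ : Involution F D) : ℕ∞ :=
  sSup {n : ℕ∞ | ∃ (V : Type v) (_ : AddCommGroup V) (_ : Module Dᵐᵒᵖ V)
    (_ : Module.Finite Dᵐᵒᵖ V) (q : QuadForm θ V),
    q.Anisotropic ∧ q.Nonsingular ∧ n = (Module.finrank Dᵐᵒᵖ V : ℕ∞)}

end Forms

end GenQuad

namespace GenQuad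

open Module
open scoped Quaternion

/-! ### Dimension counts over a field. -/

section Dimension

variable {F V : Type*} [Field F] [AddCommGroup V] [Module F V]

/-! Everything reduces to the canonical involution γ. The algebra has generators with u² = u + a, v²
= b, vu = (u + 1)v (`IsQuaternionAlgebra.exists_algEquiv`), so γ exists. Any involution θ satisfies
θ(x)s = sγ(x) for some γ-symmetric s ≠ 0 (`exists_symmetric_intertwines`), and multiplying values by
s⁻¹ turns forms over θ into forms over γ, preserving dimension, anisotropy and nondegeneracy. For γ,
Alt is F and the symmetric elements are those of reduced trace 0.

Lower bounds. The hermitian form ⟨1, c⟩ with c symmetric outside F is anisotropic. A ternary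
diagonal quadratic form whose coefficients have reduced trace 1 and reduced norms summing to 0 is
nonsingular, and anisotropic because a nontrivial zero would produce an element of trace 1 and norm
g² + g with g in F, hence a nonzero element of norm 0 (`reducedNorm_binary_ne`,
`eq_zero_of_ternary_eq_algebraMap`).

Upper bounds. When [F : F²] = 2, an additive f with f(cx) = c²f(x) vanishes on a subspace of
codimension at most 2 (`exists_submodule_of_frobenius_semilinear`). It follows that F-quadratic
forms of dimension at least 5 are isotropic. For h hermitian over γ, the condition h(x, x) ∈ F is
the vanishing of two such functions, so it holds on an F-subspace of codimension at most 4; if dim V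
≥ 3 over Q, this subspace has F-dimension at least 8, and h(x, x) is an F-quadratic form on it,
hence isotropic. For a quadratic form q with polar form h, h(x, x) ∈ F always; in dimension 4 there
are two independent, mutually orthogonal h-isotropic vectors. On their span q is totally singular,
and the same codimension count makes it isotropic. -/

theorem exists_mem_notMem_of_finrank_lt [FiniteDimensional F V] {U W : Submodule F V}
    (h : finrank F W < finrank F U) : ∃ x ∈ U, x ∉ W := by
  by_contra! hle
  exact absurd (Submodule.finrank_mono (show U ≤ W from hle)) (by omega)

theorem finrank_le_finrank_ker_inf [FiniteDimensional F V] (U : Submodule F V) (f : V →ₗ[F] F) :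
    finrank F U ≤ finrank F (U ⊓ LinearMap.ker f : Submodule F V) + 1 := by
  have h1 := Submodule.finrank_sup_add_finrank_inf_eq U (LinearMap.ker f)
  have h2 := Submodule.finrank_le (U ⊔ LinearMap.ker f)
  have h3 := f.finrank_range_add_finrank_ker
  have h4 := Submodule.finrank_le (LinearMap.range f)
  rw [finrank_self] at h4
  omega

end Dimension

/-! ### Frobenius-semilinear maps and quadratic forms when [F : F²] = 2. -/

section Squares

variable {F : Type*} [Field F] [CharP F 2]

/-- The right side says that 1, t is a basis of F over F². This coordinate form is the one used
everywhere below. -/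
theorem degreeOverSquaresEq_two_iff : DegreeOverSquaresEq F 2 ↔
    ∃ t : F, (∀ x, ∃ g h, x = g ^ 2 + t * h ^ 2) ∧ ∀ g, g ^ 2 ≠ t := by
  have hmem : ∀ x : F, x ∈ (frobenius F 2).fieldRange ↔ ∃ g, g ^ 2 = x := fun x => by
    simp [RingHom.mem_fieldRange, frobenius_def]
  have hsmul : ∀ (s : (frobenius F 2).fieldRange) (x : F), s • x = (s : F) * x := fun _ _ => rfl
  have hind : ∀ t : F, (∀ g, g ^ 2 ≠ t) →
      LinearIndependent (frobenius F 2).fieldRange ![(1 : F), t] := by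
    intro t ht
    rw [LinearIndependent.pair_iff]
    intro s r hsr
    rw [hsmul, hsmul, mul_one] at hsr
    by_cases hr : r = 0
    · subst hr
      simpa using hsr
    · exfalso
      have hr' : (r : F) ≠ 0 := by simpa using hr
      have hneg : t = -(s : F) / r := by
        field_simp
        linear_combination hsr
      obtain ⟨g, hg⟩ := (hmem _).1 (-s / r).2
      refine ht g ?_
      rw [hg, hneg]
      simp
  constructor
  · intro h
    have h' : finrank (frobenius F 2).fieldRange F = 2 := h
    obtain ⟨t, ht⟩ : ∃ t : F, ∀ g, g ^ 2 ≠ t := by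
      by_contra! hall
      have : finrank (frobenius F 2).fieldRange F ≤ 1 :=
        finrank_le_one (1 : F) fun w => ⟨⟨w, (hmem w).2 (hall w)⟩, by rw [hsmul]; simp⟩
      omega
    refine ⟨t, fun x => ?_, ht⟩
    -- A positive `finrank` excludes the default value 0 of infinite extensions.
    have : FiniteDimensional (frobenius F 2).fieldRange F :=
      finite_of_finrank_pos (by omega)
    have hspan := (hind t ht).span_eq_top_of_card_eq_finrank' (by rw [h', Fintype.card_fin])
    have hx : x ∈ Submodule.span (frobenius F 2).fieldRange (Set.range ![(1 : F), t]) := by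
      rw [hspan]; trivial
    rw [Matrix.range_cons, Matrix.range_cons, Matrix.range_empty, Set.union_empty,
      Set.singleton_union, Submodule.mem_span_pair] at hx
    obtain ⟨s, r, hx⟩ := hx
    obtain ⟨g, hg⟩ := (hmem _).1 s.2
    obtain ⟨k, hk⟩ := (hmem _).1 r.2
    refine ⟨g, k, ?_⟩
    rw [← hx, hsmul, hsmul, hg, hk]
    ring
  · rintro ⟨t, hx, ht⟩
    have hb := Basis.mk (hind t ht) (fun x _ => by
      rw [Matrix.range_cons, Matrix.range_cons, Matrix.range_empty, Set.union_empty,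
        Set.singleton_union, Submodule.mem_span_pair]
      obtain ⟨g, h, rfl⟩ := hx x
      refine ⟨⟨g ^ 2, (hmem _).2 ⟨g, rfl⟩⟩, ⟨h ^ 2, (hmem _).2 ⟨h, rfl⟩⟩, ?_⟩
      rw [hsmul, hsmul]
      simp [mul_comm])
    have := finrank_eq_card_basis hb
    rw [Fintype.card_fin] at this
    exact this

/-- If b ≠ d, then t would be the square of (a + c)/(b + d); once b = d, injectivity of Frobenius
gives a = c. -/
theorem eq_of_sq_add_mul_sq {t : F} (ht : ∀ g, g ^ 2 ≠ t) {a b c d : F}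
    (h : a ^ 2 + t * b ^ 2 = c ^ 2 + t * d ^ 2) : a = c ∧ b = d := by
  have h2 : (2 : F) = 0 := CharTwo.two_eq_zero
  have hbd : b = d := by
    by_contra hne
    have hne' : b + d ≠ 0 := fun h0 => hne (CharTwo.add_eq_zero.1 h0)
    refine ht ((a + c) / (b + d)) ?_
    rw [div_pow, div_eq_iff (pow_ne_zero 2 hne')]
    linear_combination h + (a * c + c ^ 2 - t * b * d - t * b ^ 2) * h2
  subst hbd
  refine ⟨?_, rfl⟩
  have : (a + c) ^ 2 = 0 := by linear_combination h + (a * c + c ^ 2) * h2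
  exact CharTwo.add_eq_zero.1 (pow_eq_zero_iff two_ne_zero |>.1 this)

variable {V : Type*} [AddCommGroup V] [Module F V]

/-- When `[F : F²] = 2`, a Frobenius-semilinear functional is controlled by two linear ones. -/
theorem exists_linearMap_of_frobenius_semilinear (hF : DegreeOverSquaresEq F 2) (f : V → F)
    (hadd : ∀ x y, f (x + y) = f x + f y) (hsmul : ∀ (c : F) x, f (c • x) = c ^ 2 * f x) :
    ∃ g : V →ₗ[F] F × F, ∀ x, g x = 0 → f x = 0 := by
  obtain ⟨t, hx, ht⟩ := degreeOverSquaresEq_two_iff.1 hF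
  -- Writing f = p² + t r², uniqueness of the coordinates makes p and r genuinely F-linear.
  choose p r hpr using fun x => hx (f x)
  have h2 : (2 : F) = 0 := CharTwo.two_eq_zero
  have hA : ∀ x y, p (x + y) = p x + p y ∧ r (x + y) = r x + r y := fun x y => by
    apply eq_of_sq_add_mul_sq ht
    linear_combination hadd x y - hpr (x + y) + hpr x + hpr y -
      (p x * p y + t * r x * r y) * h2
  have hS : ∀ (c : F) x, p (c • x) = c * p x ∧ r (c • x) = c * r x := fun c x => by
    apply eq_of_sq_add_mul_sq ht
    linear_combination hsmul c x - hpr (c • x) + c ^ 2 * hpr x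
  refine ⟨⟨⟨fun x => (p x, r x), fun x y => ?_⟩, fun c x => ?_⟩, fun x h => ?_⟩
  · simp [hA]
  · simp [hS]
  · have h' : (p x, r x) = 0 := h
    rw [Prod.mk_eq_zero] at h'
    rw [hpr x, h'.1, h'.2]
    ring

theorem exists_submodule_of_frobenius_semilinear [FiniteDimensional F V]
    (hF : DegreeOverSquaresEq F 2) {m : ℕ} (f : Fin m → V → F)
    (hadd : ∀ i x y, f i (x + y) = f i x + f i y)
    (hsmul : ∀ i (c : F) x, f i (c • x) = c ^ 2 * f i x) :
    ∃ W : Submodule F V, finrank F V ≤ finrank F W + 2 * m ∧ ∀ x ∈ W, ∀ i, f i x = 0 := by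
  choose g hg using fun i =>
    exists_linearMap_of_frobenius_semilinear hF (f i) (hadd i) (hsmul i)
  refine ⟨LinearMap.ker (LinearMap.pi g), ?_, fun x hx i => hg i x ?_⟩
  · have h1 := (LinearMap.pi g).finrank_range_add_finrank_ker
    have h3 := Submodule.finrank_le (LinearMap.range (LinearMap.pi g))
    rw [Module.finrank_pi_fintype] at h3
    simp only [finrank_prod, finrank_self, Finset.sum_const, Finset.card_univ, Fintype.card_fin,
      smul_eq_mul] at h3
    omega
  · exact congrFun (LinearMap.mem_ker.1 hx) i

/-- Dimension 5 leaves room for three linearly independent, pairwise orthogonal vectors. On their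
span φ is Frobenius-semilinear, so it vanishes on a subspace of dimension at least 3 − 2 = 1. -/
theorem exists_isotropic_of_five_le_finrank [FiniteDimensional F V]
    (hF : DegreeOverSquaresEq F 2) (φ : QuadraticForm F V) (hV : 5 ≤ finrank F V) :
    ∃ x ≠ 0, φ x = 0 := by
  obtain ⟨x₁, -, hx₁⟩ := exists_mem_notMem_of_finrank_lt (F := F) (V := V) (U := ⊤) (W := ⊥)
    (by rw [finrank_bot, finrank_top]; omega)
  have hk₁ := finrank_le_finrank_ker_inf ⊤ (φ.polarBilin x₁)
  rw [finrank_top, top_inf_eq] at hk₁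
  obtain ⟨x₂, hx₂, hx₂'⟩ := exists_mem_notMem_of_finrank_lt (F := F)
    (U := LinearMap.ker (φ.polarBilin x₁)) (W := Submodule.span F {x₁})
    (by have := finrank_span_singleton (K := F) (v := x₁) (by simpa using hx₁); omega)
  have hk₂ := finrank_le_finrank_ker_inf (LinearMap.ker (φ.polarBilin x₁)) (φ.polarBilin x₂)
  obtain ⟨x₃, hx₃, hx₃'⟩ := exists_mem_notMem_of_finrank_lt (F := F)
    (U := LinearMap.ker (φ.polarBilin x₁) ⊓ LinearMap.ker (φ.polarBilin x₂))
    (W := Submodule.span F {x₁, x₂})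
    (by
      classical
      have h := finrank_span_finset_le_card (R := F) ({x₁, x₂} : Finset V)
      have h' := Finset.card_le_two (a := x₁) (b := x₂)
      rw [Set.finrank, Finset.coe_pair] at h
      omega)
  have h12 : QuadraticMap.polar φ x₁ x₂ = 0 := hx₂
  have h13 : QuadraticMap.polar φ x₁ x₃ = 0 := hx₃.1
  have h23 : QuadraticMap.polar φ x₂ x₃ = 0 := hx₃.2
  have hval : ∀ a b c : F, φ (a • x₁ + b • x₂ + c • x₃) =
      a ^ 2 * φ x₁ + b ^ 2 * φ x₂ + c ^ 2 * φ x₃ := fun a b c => by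
    simp only [QuadraticMap.map_add φ, QuadraticMap.map_smul, QuadraticMap.polar_add_left,
      QuadraticMap.polar_smul_left, QuadraticMap.polar_smul_right, h12, h13, h23, smul_eq_mul]
    ring
  have h2 : (2 : F) = 0 := CharTwo.two_eq_zero
  obtain ⟨W, hW, hW'⟩ := exists_submodule_of_frobenius_semilinear (V := Fin 3 → F) hF
    (fun _ : Fin 1 => fun c => φ (c 0 • x₁ + c 1 • x₂ + c 2 • x₃))
    (fun _ c d => by
      simp only [hval, Pi.add_apply]
      linear_combination (c 0 * d 0 * φ x₁ + c 1 * d 1 * φ x₂ + c 2 * d 2 * φ x₃) * h2)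
    (fun _ c d => by simp only [hval, Pi.smul_apply, smul_eq_mul]; ring)
  rw [finrank_fin_fun] at hW
  obtain ⟨c, hc, hc0⟩ := exists_mem_notMem_of_finrank_lt (F := F) (U := W) (W := ⊥)
    (by rw [finrank_bot]; omega)
  refine ⟨_, fun h0 => hc0 ?_, hW' c hc 0⟩
  have hc2 : c 2 = 0 := by
    by_contra hne
    refine hx₃' (Submodule.mem_span_pair.2 ⟨-(c 2)⁻¹ * c 0, -(c 2)⁻¹ * c 1, ?_⟩)
    have := congrArg (fun z => (c 2)⁻¹ • z) h0
    simp only [smul_add, smul_smul, inv_mul_cancel₀ hne, one_smul, smul_zero] at this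
    linear_combination (norm := module) -this
  have hc1 : c 1 = 0 := by
    by_contra hne
    refine hx₂' (Submodule.mem_span_singleton.2 ⟨-(c 1)⁻¹ * c 0, ?_⟩)
    have := congrArg (fun z => (c 1)⁻¹ • z) h0
    simp only [smul_add, smul_smul, inv_mul_cancel₀ hne, one_smul, smul_zero, hc2, zero_smul,
      add_zero] at this
    linear_combination (norm := module) -this
  have hc0 : c 0 = 0 := by
    rw [hc1, hc2, zero_smul, zero_smul, add_zero, add_zero] at h0
    exact (smul_eq_zero.1 h0).resolve_right (by simpa using hx₁)
  rw [Submodule.mem_bot]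
  ext i
  fin_cases i <;> simp [hc0, hc1, hc2]

end Squares

/-! ### Laurent series over a perfect field: [F : F²] = 2. -/

section Laurent

variable {k : Type*} [Field k] [CharP k 2]

theorem coeff_sq_powerSeries (f : PowerSeries k) (n : ℕ) :
    PowerSeries.coeff n (f ^ 2) = if 2 ∣ n then PowerSeries.coeff (n / 2) f ^ 2 else 0 := by
  classical
  rw [sq, PowerSeries.coeff_mul]
  -- Off-diagonal products cancel in pairs under swapping the indices, since the characteristic is
  -- 2.
  have hinv : ∑ x ∈ (Finset.HasAntidiagonal.antidiagonal n).filter (fun x => x.1 ≠ x.2),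
      PowerSeries.coeff x.1 f * PowerSeries.coeff x.2 f = 0 := by
    refine Finset.sum_involution (fun x _ => x.swap) (fun x _ => ?_) (fun x hx _ h => ?_)
      (fun x hx => ?_) (fun x _ => by simp)
    · simp only [Prod.fst_swap, Prod.snd_swap]
      rw [mul_comm, CharTwo.add_self_eq_zero]
    · exact (Finset.mem_filter.1 hx).2 (congrArg Prod.fst h).symm
    · simp only [Finset.mem_filter, Finset.HasAntidiagonal.mem_antidiagonal, Prod.fst_swap,
        Prod.snd_swap] at hx ⊢
      exact ⟨by omega, fun h => hx.2 h.symm⟩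
  rw [← Finset.sum_filter_add_sum_filter_not _ (fun x => x.1 ≠ x.2), hinv, zero_add]
  split_ifs with h
  · obtain ⟨m, rfl⟩ := h
    rw [Finset.sum_eq_single (m, m)]
    · rw [Nat.mul_div_cancel_left _ two_pos, sq]
    · rintro ⟨i, j⟩ hx hne
      simp only [Finset.mem_filter, Finset.HasAntidiagonal.mem_antidiagonal, not_not] at hx
      exact absurd (Prod.ext (by simp; omega) (by simp; omega)) hne
    · intro h
      simp at h
      omega
  · refine Finset.sum_eq_zero fun x hx => ?_
    simp only [Finset.mem_filter, Finset.HasAntidiagonal.mem_antidiagonal, not_not] at hx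
    omega

/-- Split f into its even and odd parts and take square roots of the coefficients, which exist
because k is perfect. -/
theorem powerSeries_eq_sq_add_X_mul_sq [PerfectRing k 2] (f : PowerSeries k) :
    ∃ g h : PowerSeries k, f = g ^ 2 + PowerSeries.X * h ^ 2 := by
  choose r hr using fun a : k => surjective_frobenius k 2 a
  simp only [frobenius_def] at hr
  refine ⟨PowerSeries.mk fun n => r (PowerSeries.coeff (2 * n) f),
    PowerSeries.mk fun n => r (PowerSeries.coeff (2 * n + 1) f), ?_⟩
  ext n
  rcases n with _ | n
  · simp [hr]
  · rw [map_add, PowerSeries.coeff_succ_X_mul, coeff_sq_powerSeries, coeff_sq_powerSeries,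
      PowerSeries.coeff_mk, PowerSeries.coeff_mk, hr, hr]
    rcases Nat.even_or_odd n with h | h
    · obtain ⟨m, rfl⟩ := h
      rw [if_neg (by omega), if_pos (by omega), zero_add]
      congr 2
      omega
    · obtain ⟨m, rfl⟩ := h
      rw [if_pos (by omega), if_neg (by omega), add_zero]
      congr 2
      omega

open HahnSeries in
-- The uniformizer serves as t: it is not a square because its order is 1, while squares have even
-- order.
theorem exists_laurentSeries_sq_basis [PerfectRing k 2] : ∃ t : LaurentSeries k,
    (∀ x, ∃ g h, x = g ^ 2 + t * h ^ 2) ∧ ∀ g, g ^ 2 ≠ t := by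
  refine ⟨single 1 1, fun x => ?_, fun g hg => ?_⟩
  · obtain ⟨m, P, hP⟩ : ∃ (m : ℤ) (P : PowerSeries k),
        x = single m 1 ^ 2 * ofPowerSeries ℤ k P := by
      have hx := LaurentSeries.single_order_mul_powerSeriesPart x
      -- For odd order one factor X is moved into the power series, so that the remaining monomial
      -- is a square.
      rcases Int.even_or_odd' x.order with ⟨m, hm | hm⟩
      · refine ⟨m, x.powerSeriesPart, ?_⟩
        rw [sq, single_mul_single, ← two_mul, one_mul, ← hm]
        exact hx.symm
      · refine ⟨m, PowerSeries.X * x.powerSeriesPart, ?_⟩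
        rw [map_mul, ofPowerSeries_X, sq, single_mul_single, ← mul_assoc, single_mul_single,
          ← two_mul, one_mul, one_mul, ← hm]
        exact hx.symm
    obtain ⟨g, h, rfl⟩ := powerSeries_eq_sq_add_X_mul_sq P
    refine ⟨single m 1 * ofPowerSeries ℤ k g, single m 1 * ofPowerSeries ℤ k h, ?_⟩
    rw [hP, map_add, map_mul, map_pow, map_pow, ofPowerSeries_X]
    ring
  · have hg0 : g ≠ 0 := by
      rintro rfl
      have h := congrArg (fun x => HahnSeries.coeff x 1) hg
      simp at h
    have h := congrArg HahnSeries.order hg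
    rw [sq, order_mul hg0 hg0, order_single one_ne_zero] at h
    omega

theorem IsLocalFieldCharTwo.degreeOverSquaresEq {F : Type*} [Field F] [CharP F 2]
    (hF : IsLocalFieldCharTwo F) : DegreeOverSquaresEq F 2 := by
  obtain ⟨n, -, ⟨e⟩⟩ := hF
  obtain ⟨t, ht, hns⟩ := exists_laurentSeries_sq_basis (k := GaloisField 2 n)
  refine degreeOverSquaresEq_two_iff.2 ⟨e.symm t, fun x => ?_, fun g hg => hns (e g) ?_⟩
  · obtain ⟨g, h, hx⟩ := ht (e x)
    refine ⟨e.symm g, e.symm h, ?_⟩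
    rw [← map_pow, ← map_pow, ← map_mul, ← map_add, ← hx, e.symm_apply_apply]
  · rw [← map_pow, hg, e.apply_symm_apply]

end Laurent

/-! ### Standard generators of a quaternion division algebra. -/

section Structure

variable {F D : Type*} [Field F] [DivisionRing D] [Algebra F D]

theorem eq_zero_of_smul_one_add_smul_eq_zero {x : D} (hx : ∃ y, x * y ≠ y * x) {a b : F}
    (h : a • (1 : D) + b • x = 0) : a = 0 ∧ b = 0 := by
  have hb : b = 0 := by
    by_contra hb
    obtain ⟨y, hy⟩ := hx
    have hx' : x = (-(b⁻¹ * a)) • (1 : D) := by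
      have := congrArg (fun z => b⁻¹ • z) h
      simp only [smul_add, smul_smul, inv_mul_cancel₀ hb, one_smul, smul_zero] at this
      linear_combination (norm := module) this
    exact hy (by rw [hx']; simp)
  subst hb
  simpa using h

/-- Read the relation as (a + bx) + (c + dx)y = 0. If c + dx were nonzero, it could be inverted,
placing y in the field generated by x, against noncommutativity. -/
theorem coords_eq_zero_of_not_commute {x y : D} (hxy : x * y ≠ y * x) {a b c d : F}
    (h : a • (1 : D) + b • x + c • y + d • (x * y) = 0) : (a = 0 ∧ b = 0) ∧ c = 0 ∧ d = 0 := by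
  have hp : c • (1 : D) + d • x = 0 := by
    by_contra hp
    set p : D := c • (1 : D) + d • x with hpdef
    have hy : y = p⁻¹ * -(a • (1 : D) + b • x) := by
      rw [eq_inv_mul_iff_mul_eq₀ hp, hpdef, add_mul, smul_mul_assoc, smul_mul_assoc, one_mul]
      linear_combination (norm := module) h
    have hxp : Commute x p :=
      ((Commute.one_right x).smul_right _).add_right ((Commute.refl x).smul_right _)
    refine hxy (hy ▸ ((hxp.inv_right₀).mul_right ?_ : Commute x _).eq)
    exact (((Commute.one_right x).smul_right _).add_right
      ((Commute.refl x).smul_right _)).neg_right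
  have hcd := eq_zero_of_smul_one_add_smul_eq_zero ⟨y, hxy⟩ hp
  exact ⟨eq_zero_of_smul_one_add_smul_eq_zero ⟨y, hxy⟩ (by simpa [hcd.1, hcd.2] using h), hcd⟩

theorem linearIndependent_of_not_commute {x y : D} (hxy : x * y ≠ y * x) :
    LinearIndependent F ![(1 : D), x, y, x * y] := by
  rw [Fintype.linearIndependent_iff]
  intro g hg
  simp only [Fin.sum_univ_four, Matrix.cons_val] at hg
  obtain ⟨⟨h0, h1⟩, h2, h3⟩ := coords_eq_zero_of_not_commute hxy hg
  intro i
  fin_cases i <;> assumption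

theorem IsQuaternionAlgebra.exists_not_commute (hD : IsQuaternionAlgebra F D) {x : D}
    (hx : ∀ a : F, x ≠ a • 1) : ∃ y, x * y ≠ y * x := by
  by_contra! h
  have := hD.isCentral
  have hc : x ∈ Subalgebra.center F D := Subalgebra.mem_center_iff.2 fun y => (h y).symm
  obtain ⟨a, ha⟩ := (Algebra.IsCentral.mem_center_iff F).1 hc
  exact hx a (by rw [← Algebra.algebraMap_eq_smul_one, ha])

/-- For x outside F, expand x² in the basis 1, x, y, xy. A nonzero coefficient c + dx of y would
again express y through x and make the two commute. -/
theorem IsQuaternionAlgebra.exists_mul_self_eq (hD : IsQuaternionAlgebra F D) (x : D) :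
    ∃ a b : F, x * x = a • 1 + b • x := by
  by_cases hx : ∃ a : F, x = a • 1
  · obtain ⟨a, rfl⟩ := hx
    exact ⟨0, a, by simp⟩
  obtain ⟨y, hxy⟩ := hD.exists_not_commute (not_exists.1 hx)
  have hfin : FiniteDimensional F D := finite_of_finrank_pos (by rw [hD.finrank_eq]; norm_num)
  have hspan := (linearIndependent_of_not_commute (F := F) hxy).span_eq_top_of_card_eq_finrank'
    (by rw [hD.finrank_eq]; rfl)
  have hmem : x * x ∈ Submodule.span F (Set.range ![(1 : D), x, y, x * y]) := by
    rw [hspan]; trivial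
  obtain ⟨g, hg⟩ := (Submodule.mem_span_range_iff_exists_fun F).1 hmem
  simp only [Fin.sum_univ_four, Matrix.cons_val] at hg
  by_cases hp : g 2 • (1 : D) + g 3 • x = 0
  · refine ⟨g 0, g 1, ?_⟩
    rw [← hg, add_assoc, ← smul_mul_assoc, ← one_mul (g 2 • y), mul_smul_comm, ← smul_mul_assoc,
      ← add_mul, hp]
    simp
  · exfalso
    set p : D := g 2 • (1 : D) + g 3 • x with hpdef
    have hy : y = p⁻¹ * (x * x - (g 0 • (1 : D) + g 1 • x)) := by
      rw [eq_inv_mul_iff_mul_eq₀ hp, hpdef, add_mul, smul_mul_assoc, smul_mul_assoc, one_mul]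
      linear_combination (norm := module) hg
    have hxp : Commute x p :=
      ((Commute.one_right x).smul_right _).add_right ((Commute.refl x).smul_right _)
    refine hxy (hy ▸ ((hxp.inv_right₀).mul_right ?_ : Commute x _).eq)
    exact ((Commute.refl x).mul_right (Commute.refl x)).sub_right
      (((Commute.one_right x).smul_right _).add_right ((Commute.refl x).smul_right _))

variable [CharP F 2]

/-- A noncentral x with x² = a + bx and b ≠ 0 is rescaled by b⁻¹. If there were none, noncentral
elements would all have squares in F; for noncommuting x and y, polarizing gives xy + yx = c ∈ F,
nonzero, and then c⁻¹xy is still a suitable u. -/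
theorem IsQuaternionAlgebra.exists_separable_generator (hD : IsQuaternionAlgebra F D) :
    ∃ (u w : D) (a : F), u * u = a • 1 + u ∧ u * w ≠ w * u := by
  have : CharP D 2 := charP_of_injective_algebraMap (algebraMap F D).injective 2
  have h2 : (2 : D) = 0 := CharTwo.two_eq_zero
  by_cases hsep : ∃ (x : D) (a b : F), (∃ y, x * y ≠ y * x) ∧ x * x = a • 1 + b • x ∧ b ≠ 0
  · obtain ⟨x, a, b, ⟨y, hy⟩, hx, hb⟩ := hsep
    refine ⟨b⁻¹ • x, y, b⁻¹ * b⁻¹ * a, ?_, fun h => hy ?_⟩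
    · rw [smul_mul_smul_comm, hx, smul_add, smul_smul, smul_smul, mul_assoc b⁻¹ b⁻¹ b,
        inv_mul_cancel₀ hb, mul_one]
    · rw [smul_mul_assoc, mul_smul_comm] at h
      exact smul_right_injective D (inv_ne_zero hb) h
  push Not at hsep
  have hsq : ∀ x : D, (∃ y, x * y ≠ y * x) → ∃ a : F, x * x = a • 1 := fun x hx => by
    obtain ⟨a, b, hab⟩ := hD.exists_mul_self_eq x
    exact ⟨a, by rw [hab, hsep x a b hx hab, zero_smul, add_zero]⟩
  obtain ⟨x, hx⟩ : ∃ x : D, ∀ a : F, x ≠ a • 1 := by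
    by_contra! h
    have := finrank_le_one (1 : D) fun x => (h x).imp fun a ha => ha.symm
    rw [hD.finrank_eq] at this
    omega
  obtain ⟨y, hxy⟩ := hD.exists_not_commute hx
  obtain ⟨a, ha⟩ := hsq x ⟨y, hxy⟩
  obtain ⟨b, hb⟩ := hsq y ⟨x, hxy.symm⟩
  obtain ⟨d, hd⟩ := hsq (x + y) ⟨y, fun h => hxy (by
    rw [add_mul, mul_add] at h
    exact add_right_cancel h)⟩
  obtain ⟨c, hc⟩ : ∃ c : F, y * x = c • 1 - x * y := ⟨d - a - b, by
    rw [sub_smul, sub_smul, ← ha, ← hb, ← hd]; noncomm_ring⟩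
  have hc0 : c ≠ 0 := by
    rintro rfl
    refine hxy ?_
    rw [hc, zero_smul, zero_sub, CharTwo.neg_eq]
  refine ⟨c⁻¹ • (x * y), x, -(c⁻¹ * c⁻¹ * (a * b)), ?_, fun h => hc0 ?_⟩
  · have h1 : x * y * (x * y) = c • (x * y) - (a * b) • 1 := by
      calc x * y * (x * y) = x * (y * x) * y := by noncomm_ring
        _ = c • (x * y) - (x * x) * (y * y) := by
          rw [hc, mul_sub, sub_mul, mul_smul_comm, mul_one, smul_mul_assoc]; noncomm_ring
        _ = _ := by rw [ha, hb, smul_mul_smul_comm, one_mul]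
    rw [smul_mul_smul_comm, h1, smul_sub, smul_smul, smul_smul, mul_assoc c⁻¹ c⁻¹ c,
      inv_mul_cancel₀ hc0, mul_one, neg_smul]
    abel
  · rw [smul_mul_assoc, mul_smul_comm] at h
    have h1 := smul_right_injective D (inv_ne_zero hc0) h
    rw [mul_assoc, hc, mul_sub, mul_smul_comm, mul_one, sub_eq_iff_eq_add, ← two_mul, h2,
      zero_mul] at h1
    exact (smul_eq_zero.1 h1).resolve_right fun h0 => hxy (by rw [h0]; simp)

theorem IsQuaternionAlgebra.exists_generators (hD : IsQuaternionAlgebra F D) :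
    ∃ (u v : D) (a b : F), u * u = a • 1 + u ∧ v * v = b • 1 ∧ v * u = v - u * v ∧
      u * v ≠ v * u := by
  have : CharP D 2 := charP_of_injective_algebraMap (algebraMap F D).injective 2
  have h2 : (2 : D) = 0 := CharTwo.two_eq_zero
  obtain ⟨u, w, a, hu, huw⟩ := hD.exists_separable_generator
  -- The commutator of u and w satisfies vu = (1 + u)v: it conjugates u to the other root of its
  -- quadratic equation.
  obtain ⟨v, hv⟩ : ∃ v, v = u * w + w * u := ⟨_, rfl⟩
  have hv0 : v ≠ 0 := fun h => huw (CharTwo.add_eq_zero.1 (hv ▸ h))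
  have hvu : v * u = v - u * v := by
    have hl : u * (u * w) = a • w + u * w := by
      rw [← mul_assoc, hu, add_mul, smul_mul_assoc, one_mul]
    have hr : w * u * u = a • w + w * u := by
      rw [mul_assoc, hu, mul_add, mul_smul_comm, mul_one]
    rw [hv, add_mul, mul_add, hl, hr]
    have h3 : u * w * u = u * (w * u) := mul_assoc _ _ _
    generalize a • w = z
    linear_combination (norm := noncomm_ring) h3 + h2 * z + h2 * (u * (w * u))
  obtain ⟨b, c, hbc⟩ := hD.exists_mul_self_eq v
  have hne : u * v ≠ v * u := fun h => hv0 <| by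
    rw [← h, eq_sub_iff_add_eq, ← two_mul, h2, zero_mul] at hvu
    exact hvu.symm
  have hvv : v * v * u = u * (v * v) := by
    rw [mul_assoc, hvu, mul_sub, ← mul_assoc, hvu]
    noncomm_ring
  -- Since v² commutes with u and v does not, v² can have no component along v.
  have hc : c = 0 := by
    by_contra hc
    refine hne ?_
    rw [hbc, add_mul, mul_add, smul_mul_assoc, smul_mul_assoc, one_mul, mul_smul_comm, mul_one,
      mul_smul_comm] at hvv
    exact (smul_right_injective D hc (add_left_cancel hvv)).symm
  rw [hc, zero_smul, add_zero] at hbc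
  exact ⟨u, v, a, b, hu, hbc, hvu, hne⟩

theorem IsQuaternionAlgebra.exists_algEquiv (hD : IsQuaternionAlgebra F D) :
    ∃ a b : F, Nonempty (D ≃ₐ[F] ℍ[F, a, 1, b]) := by
  obtain ⟨u, v, a, b, hu, hbc, hvu, hne⟩ := hD.exists_generators
  let q : QuaternionAlgebra.Basis D a 1 b :=
    { i := u, j := v, k := u * v, i_mul_i := by rw [hu, one_smul], j_mul_j := hbc
      i_mul_j := rfl, j_mul_i := by rw [hvu, one_smul] }
  have hinj : Function.Injective q.liftHom := by
    rw [injective_iff_map_eq_zero]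
    intro x hx
    have hx' : algebraMap F D x.re + x.imI • u + x.imJ • v + x.imK • (u * v) = 0 := hx
    rw [Algebra.algebraMap_eq_smul_one] at hx'
    obtain ⟨⟨h0, h1⟩, h2, h3⟩ := coords_eq_zero_of_not_commute hne hx'
    exact QuaternionAlgebra.ext h0 h1 h2 h3
  have hfin : FiniteDimensional F D := finite_of_finrank_pos (by rw [hD.finrank_eq]; norm_num)
  have hsurj : Function.Surjective q.liftHom :=
    (LinearMap.injective_iff_surjective_of_finrank_eq_finrank (f := q.liftHom.toLinearMap)
      (by rw [QuaternionAlgebra.finrank_eq_four, hD.finrank_eq]; norm_num)).1 hinj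
  exact ⟨a, b, ⟨(AlgEquiv.ofBijective q.liftHom ⟨hinj, hsurj⟩).symm⟩⟩

end Structure

/-! ### Involutions, and scaling of forms between two of them. -/

section Involution

variable {F D : Type*} [Field F] [DivisionRing D] [Algebra F D]

namespace Involution

variable (θ : Involution F D)

theorem toFun_add (x y : D) : θ.toFun (x + y) = θ.toFun x + θ.toFun y := θ.map_add' x y

theorem toFun_smul (c : F) (x : D) : θ.toFun (c • x) = c • θ.toFun x := θ.map_smul' c x

theorem toFun_zero : θ.toFun 0 = 0 := θ.toLinearMap.map_zero

theorem toFun_one : θ.toFun 1 = 1 := by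
  have h := θ.map_mul' (θ.toFun 1) 1
  rw [mul_one, θ.involutive', mul_one] at h
  exact h.symm

theorem toFun_algebraMap (c : F) : θ.toFun (algebraMap F D c) = algebraMap F D c := by
  rw [Algebra.algebraMap_eq_smul_one, toFun_smul, toFun_one]

theorem toFun_ne_zero {x : D} (hx : x ≠ 0) : θ.toFun x ≠ 0 := fun h => hx <| by
  rw [← θ.involutive' x, h, toFun_zero]

theorem toFun_inv (x : D) : θ.toFun x⁻¹ = (θ.toFun x)⁻¹ := by
  rcases eq_or_ne x 0 with rfl | hx
  · rw [inv_zero, toFun_zero, inv_zero]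
  · apply eq_inv_of_mul_eq_one_left
    rw [← θ.map_mul', mul_inv_cancel₀ hx, toFun_one]

theorem mem_alt {x : D} : x ∈ θ.alt ↔ ∃ y, y - θ.toFun y = x := Iff.rfl

theorem quotSandwich_mk (d a : D) :
    θ.quotSandwich d (Submodule.Quotient.mk a) = Submodule.Quotient.mk (θ.toFun d * (a * d)) :=
  rfl

end Involution

section Scaling

variable {θ θ' : Involution F D} {s : D}

theorem inv_mul_toFun_of_intertwines (hs : s ≠ 0)
    (hθ : ∀ x, θ.toFun x * s = s * θ'.toFun x) (x : D) :
    s⁻¹ * θ.toFun x = θ'.toFun x * s⁻¹ := by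
  rw [inv_mul_eq_iff_eq_mul₀ hs, ← mul_assoc, ← hθ, mul_inv_cancel_right₀ hs]

/-- The identity s⁻¹(y − θ(y)) = z − θ'(z) holds with z = s⁻¹y; symmetry of s is what makes θ'(z) =
θ'(y)s⁻¹. -/
theorem alt_le_comap_of_intertwines (hs : s ≠ 0)
    (hθ : ∀ x, θ.toFun x * s = s * θ'.toFun x) (hs' : θ'.toFun s = s) :
    θ.alt ≤ θ'.alt.comap (LinearMap.mulLeft F s⁻¹) := by
  intro x hx
  obtain ⟨y, rfl⟩ := θ.mem_alt.1 hx
  refine θ'.mem_alt.2 ⟨s⁻¹ * y, ?_⟩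
  rw [θ'.map_mul', θ'.toFun_inv, hs', ← inv_mul_toFun_of_intertwines hs hθ]
  simp [mul_sub]

variable {V : Type*} [AddCommGroup V] [Module Dᵐᵒᵖ V]

/-- Scaling by `s⁻¹` turns a hermitian form over `(D, θ)` into one over `(D, θ')` when
`θ = Int(s) ∘ θ'`. -/
def HermitianForm.scale (hs : s ≠ 0) (hθ : ∀ x, θ.toFun x * s = s * θ'.toFun x)
    (hs' : θ'.toFun s = s) (h : HermitianForm θ V) : HermitianForm θ' V where
  toFun x y := s⁻¹ * h.toFun x y
  add_left x x' y := by rw [h.add_left, mul_add]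
  add_right x y y' := by rw [h.add_right, mul_add]
  smul_smul x y d₁ d₂ := by
    rw [h.smul_smul, ← mul_assoc, ← mul_assoc, inv_mul_toFun_of_intertwines hs hθ, mul_assoc _ s⁻¹]
  symm x y := by
    rw [h.symm, θ'.map_mul', θ'.toFun_inv, hs', inv_mul_toFun_of_intertwines hs hθ]

/-- Scaling by `s⁻¹` turns a quadratic form over `(D, θ)` into one over `(D, θ')` when
`θ = Int(s) ∘ θ'`. -/
def QuadForm.scale (hs : s ≠ 0) (hθ : ∀ x, θ.toFun x * s = s * θ'.toFun x)
    (hs' : θ'.toFun s = s) (q : QuadForm θ V) : QuadForm θ' V where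
  toFun x := θ.alt.mapQ θ'.alt (LinearMap.mulLeft F s⁻¹)
    (alt_le_comap_of_intertwines hs hθ hs') (q.toFun x)
  polar := q.polar.scale hs hθ hs'
  map_smul x d := by
    rw [q.map_smul]
    obtain ⟨a, ha⟩ := Submodule.Quotient.mk_surjective _ (q.toFun x)
    rw [← ha, θ.quotSandwich_mk, Submodule.mapQ_apply, Submodule.mapQ_apply, θ'.quotSandwich_mk]
    congr 1
    rw [LinearMap.mulLeft_apply, LinearMap.mulLeft_apply, ← mul_assoc,
      inv_mul_toFun_of_intertwines hs hθ, mul_assoc, mul_assoc]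
  map_add x y := by
    rw [← map_sub, ← map_sub, q.map_add, Submodule.mapQ_apply]
    rfl

theorem HermitianForm.Anisotropic.scale (hs : s ≠ 0)
    (hθ : ∀ x, θ.toFun x * s = s * θ'.toFun x) (hs' : θ'.toFun s = s) {h : HermitianForm θ V}
    (ha : h.Anisotropic) : (h.scale hs hθ hs').Anisotropic := fun x hx =>
  mul_ne_zero (inv_ne_zero hs) (ha x hx)

theorem HermitianForm.Nondegenerate.scale (hs : s ≠ 0)
    (hθ : ∀ x, θ.toFun x * s = s * θ'.toFun x) (hs' : θ'.toFun s = s) {h : HermitianForm θ V}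
    (ha : h.Nondegenerate) : (h.scale hs hθ hs').Nondegenerate := fun x hx =>
  ha x fun y => (mul_eq_zero.1 (hx y)).resolve_left (inv_ne_zero hs)

theorem intertwines_symm (hs : s ≠ 0) (hθ : ∀ x, θ.toFun x * s = s * θ'.toFun x)
    (hs' : θ'.toFun s = s) :
    (∀ x, θ'.toFun x * s⁻¹ = s⁻¹ * θ.toFun x) ∧ θ.toFun s⁻¹ = s⁻¹ := by
  refine ⟨fun x => (inv_mul_toFun_of_intertwines hs hθ x).symm, ?_⟩
  have h := hθ s
  rw [hs'] at h
  rw [θ.toFun_inv, mul_right_cancel₀ hs h]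

theorem QuadForm.Anisotropic.scale (hs : s ≠ 0)
    (hθ : ∀ x, θ.toFun x * s = s * θ'.toFun x) (hs' : θ'.toFun s = s) {q : QuadForm θ V}
    (ha : q.Anisotropic) : (q.scale hs hθ hs').Anisotropic := by
  intro x hx h
  refine ha x hx ?_
  obtain ⟨a, haq⟩ := Submodule.Quotient.mk_surjective _ (q.toFun x)
  have h' : θ.alt.mapQ θ'.alt (LinearMap.mulLeft F s⁻¹)
    (alt_le_comap_of_intertwines hs hθ hs') (q.toFun x) = 0 := h
  rw [← haq, Submodule.mapQ_apply, Submodule.Quotient.mk_eq_zero, LinearMap.mulLeft_apply] at h'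
  rw [← haq, Submodule.Quotient.mk_eq_zero]
  obtain ⟨hθ₂, hs₂⟩ := intertwines_symm hs hθ hs'
  have := alt_le_comap_of_intertwines (inv_ne_zero hs) hθ₂ hs₂ h'
  simpa [hs] using this

theorem uPlus_le_of_intertwines (hs : s ≠ 0) (hθ : ∀ x, θ.toFun x * s = s * θ'.toFun x)
    (hs' : θ'.toFun s = s) : uPlus θ ≤ uPlus θ' := by
  refine sSup_le_sSup ?_
  rintro n ⟨V, _, _, hV, h, ha, hn⟩
  exact ⟨V, _, _, hV, h.scale hs hθ hs', ha.scale hs hθ hs', hn⟩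

theorem uQuad_le_of_intertwines (hs : s ≠ 0) (hθ : ∀ x, θ.toFun x * s = s * θ'.toFun x)
    (hs' : θ'.toFun s = s) : uQuad θ ≤ uQuad θ' := by
  refine sSup_le_sSup ?_
  rintro n ⟨V, _, _, hV, q, ha, hn⟩
  exact ⟨V, _, _, hV, q.scale hs hθ hs', ha.scale hs hθ hs', hn⟩

theorem uTilde_le_of_intertwines (hs : s ≠ 0) (hθ : ∀ x, θ.toFun x * s = s * θ'.toFun x)
    (hs' : θ'.toFun s = s) : uTilde θ ≤ uTilde θ' := by
  refine sSup_le_sSup ?_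
  rintro n ⟨V, _, _, hV, q, ha, hns, hn⟩
  exact ⟨V, _, _, hV, q.scale hs hθ hs', ha.scale hs hθ hs',
    HermitianForm.Nondegenerate.scale hs hθ hs' hns, hn⟩

end Scaling

end Involution

/-! ### The canonical involution, reduced trace and reduced norm. -/

section Canonical

variable {F D : Type*} [Field F] [DivisionRing D] [Algebra F D] {a b : F}

/-- The canonical involution of a quaternion algebra. -/
def canonicalInvolution (e : D ≃ₐ[F] ℍ[F, a, 1, b]) : Involution F D where
  toFun x := e.symm (star (e x))
  map_add' x y := by simp
  map_smul' c x := by simp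
  map_mul' x y := by simp
  involutive' x := by simp

/-- The reduced trace in characteristic `2`. -/
def reducedTrace (e : D ≃ₐ[F] ℍ[F, a, 1, b]) : D →ₗ[F] F :=
  (QuaternionAlgebra.imIₗ a 1 b).comp e.toLinearMap

/-- The reduced norm. -/
def reducedNorm (e : D ≃ₐ[F] ℍ[F, a, 1, b]) (x : D) : F := (star (e x) * e x).re

variable (e : D ≃ₐ[F] ℍ[F, a, 1, b])

theorem reducedTrace_apply (x : D) : reducedTrace e x = (e x).imI := rfl

theorem reducedTrace_algebraMap (c : F) : reducedTrace e (algebraMap F D c) = 0 := by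
  rw [reducedTrace_apply, AlgEquiv.commutes]; rfl

theorem canonicalInvolution_mul_self (x : D) :
    (canonicalInvolution e).toFun x * x = algebraMap F D (reducedNorm e x) := by
  apply e.injective
  rw [map_mul, AlgEquiv.commutes]
  have h : e ((canonicalInvolution e).toFun x) = star (e x) := e.apply_symm_apply _
  rw [h]
  exact QuaternionAlgebra.star_mul_eq_coe _

theorem mem_range_algebraMap_of_coords {x : D} (h₁ : (e x).imI = 0) (h₂ : (e x).imJ = 0)
    (h₃ : (e x).imK = 0) : x = algebraMap F D (e x).re := by
  apply e.injective
  rw [AlgEquiv.commutes]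
  ext
  · rfl
  · exact h₁
  · exact h₂
  · exact h₃

theorem reducedNorm_eq_zero_iff {x : D} : reducedNorm e x = 0 ↔ x = 0 := by
  constructor
  · intro h
    have h' := canonicalInvolution_mul_self e x
    rw [h, map_zero, mul_eq_zero] at h'
    by_contra hx
    exact h'.elim ((canonicalInvolution e).toFun_ne_zero hx) hx
  · rintro rfl
    simp [reducedNorm]

theorem reducedNorm_mul (x y : D) : reducedNorm e (x * y) = reducedNorm e x * reducedNorm e y := by
  apply (algebraMap F D).injective
  rw [← canonicalInvolution_mul_self, (canonicalInvolution e).map_mul', mul_assoc,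
    ← mul_assoc _ x, canonicalInvolution_mul_self, Algebra.left_comm,
    canonicalInvolution_mul_self, map_mul]

theorem reducedNorm_algebraMap (c : F) : reducedNorm e (algebraMap F D c) = c ^ 2 := by
  apply (algebraMap F D).injective
  rw [← canonicalInvolution_mul_self, (canonicalInvolution e).toFun_algebraMap, ← map_mul, sq]

theorem reducedNorm_smul (c : F) (x : D) : reducedNorm e (c • x) = c ^ 2 * reducedNorm e x := by
  rw [Algebra.smul_def, reducedNorm_mul, reducedNorm_algebraMap]

variable [CharP F 2]

theorem reducedTrace_mul_comm (x y : D) : reducedTrace e (x * y) = reducedTrace e (y * x) := by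
  simp only [reducedTrace_apply, map_mul, QuaternionAlgebra.imI_mul]
  linear_combination (b * (e x).imK * (e y).imJ - b * (e x).imJ * (e y).imK) *
    (CharTwo.two_eq_zero : (2 : F) = 0)

theorem canonicalInvolution_eq (x : D) :
    (canonicalInvolution e).toFun x = x + algebraMap F D (reducedTrace e x) := by
  apply e.injective
  have h : e ((canonicalInvolution e).toFun x) = star (e x) := e.apply_symm_apply _
  rw [h, map_add, AlgEquiv.commutes, reducedTrace_apply]
  ext <;> simp [QuaternionAlgebra.algebraMap_eq, CharTwo.neg_eq]

theorem mul_canonicalInvolution_self (x : D) :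
    x * (canonicalInvolution e).toFun x = algebraMap F D (reducedNorm e x) := by
  rw [← canonicalInvolution_mul_self, canonicalInvolution_eq, mul_add, add_mul, Algebra.commutes]

theorem reducedNorm_canonicalInvolution (x : D) :
    reducedNorm e ((canonicalInvolution e).toFun x) = reducedNorm e x := by
  apply (algebraMap F D).injective
  rw [← canonicalInvolution_mul_self, (canonicalInvolution e).involutive',
    mul_canonicalInvolution_self]

theorem reducedTrace_canonicalInvolution (x : D) :
    reducedTrace e ((canonicalInvolution e).toFun x) = reducedTrace e x := by
  rw [canonicalInvolution_eq, map_add, reducedTrace_algebraMap, add_zero]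

theorem add_canonicalInvolution (x : D) :
    x + (canonicalInvolution e).toFun x = algebraMap F D (reducedTrace e x) := by
  have : CharP D 2 := charP_of_injective_algebraMap (algebraMap F D).injective 2
  rw [canonicalInvolution_eq, ← add_assoc, CharTwo.add_self_eq_zero, zero_add]

theorem reducedNorm_add (x y : D) : reducedNorm e (x + y) = reducedNorm e x + reducedNorm e y +
    reducedTrace e ((canonicalInvolution e).toFun x * y) := by
  apply (algebraMap F D).injective
  rw [map_add, map_add, ← add_canonicalInvolution, ← canonicalInvolution_mul_self,
    ← canonicalInvolution_mul_self, ← canonicalInvolution_mul_self,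
    (canonicalInvolution e).map_mul', (canonicalInvolution e).toFun_add,
    (canonicalInvolution e).involutive']
  noncomm_ring

theorem canonicalInvolution_eq_self_iff {x : D} :
    (canonicalInvolution e).toFun x = x ↔ reducedTrace e x = 0 := by
  rw [canonicalInvolution_eq, add_eq_left, map_eq_zero]

/-- In characteristic 2, y − γ(y) is the reduced trace of y, and the trace is onto F: c times the
first generator has trace c. -/
theorem mem_alt_canonicalInvolution {x : D} :
    x ∈ (canonicalInvolution e).alt ↔ ∃ c, algebraMap F D c = x := by
  have : CharP D 2 := charP_of_injective_algebraMap (algebraMap F D).injective 2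
  rw [Involution.mem_alt]
  constructor
  · rintro ⟨y, rfl⟩
    exact ⟨reducedTrace e y, by rw [CharTwo.sub_eq_add, add_canonicalInvolution]⟩
  · rintro ⟨c, rfl⟩
    refine ⟨e.symm ⟨0, c, 0, 0⟩, ?_⟩
    rw [CharTwo.sub_eq_add, add_canonicalInvolution, reducedTrace_apply, e.apply_symm_apply]

/-- An element of reduced trace `1` of a division quaternion algebra does not have its reduced norm
of the form `c² + c`. -/
theorem reducedNorm_ne_of_reducedTrace_eq_one {x : D} (hx : reducedTrace e x = 1) (c : F) :
    reducedNorm e x ≠ c ^ 2 + c := by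
  have : CharP D 2 := charP_of_injective_algebraMap (algebraMap F D).injective 2
  intro h
  -- Translating a trace-1 element by c adds c² + c to its norm; norm 0 then forces x = c, which has
  -- trace 0.
  have h0 : reducedNorm e (x + algebraMap F D c) = 0 := by
    have h2 : (2 : F) = 0 := CharTwo.two_eq_zero
    rw [reducedNorm_add, reducedNorm_algebraMap, ← Algebra.commutes, ← Algebra.smul_def, map_smul,
      reducedTrace_canonicalInvolution, hx, h, smul_eq_mul]
    linear_combination (c ^ 2 + c) * h2
  rw [reducedNorm_eq_zero_iff, CharTwo.add_eq_zero] at h0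
  rw [h0, reducedTrace_algebraMap] at hx
  exact zero_ne_one hx

end Canonical

/-! ### Every involution is the canonical one followed by conjugation. -/

section SkolemNoether

variable {F D : Type*} [Field F] [DivisionRing D] [Algebra F D] {a b : F}

theorem ne_zero_of_algEquiv_quaternionAlgebra (e : D ≃ₐ[F] ℍ[F, a, 1, b]) : b ≠ 0 := by
  rintro rfl
  have h : e.symm ⟨0, 0, 1, 0⟩ * e.symm ⟨0, 0, 1, 0⟩ = 0 := by
    apply e.injective
    rw [map_mul, map_zero, e.apply_symm_apply]
    ext <;> simp
  have h' : e.symm ⟨0, 0, 1, 0⟩ = 0 := mul_self_eq_zero.1 h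
  rw [map_eq_zero_iff _ e.symm.injective] at h'
  exact one_ne_zero (congrArg QuaternionAlgebra.imJ h')

variable [CharP F 2] (e : D ≃ₐ[F] ℍ[F, a, 1, b])

/-- The standard generators of a quaternion algebra in characteristic `2`. -/
theorem exists_standard_generators : ∃ u v : D, u * u = algebraMap F D a + u ∧
    v * v = algebraMap F D b ∧ v * u = v + u * v ∧ (canonicalInvolution e).toFun u = u + 1 ∧
    (canonicalInvolution e).toFun v = v ∧ v ≠ 0 ∧
    ∀ x : D, ∃ c₀ c₁ c₂ c₃ : F, x = c₀ • (1 : D) + c₁ • u + c₂ • v + c₃ • (u * v) := by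
  refine ⟨e.symm ⟨0, 1, 0, 0⟩, e.symm ⟨0, 0, 1, 0⟩, ?_, ?_, ?_, ?_, ?_, fun h => ?_, fun x =>
    ⟨(e x).re, (e x).imI, (e x).imJ, (e x).imK, ?_⟩⟩
  · apply e.injective
    simp only [map_mul, map_add, e.apply_symm_apply, e.commutes]
    ext <;> simp [QuaternionAlgebra.algebraMap_eq]
  · apply e.injective
    simp only [map_mul, e.apply_symm_apply, e.commutes]
    ext <;> simp [QuaternionAlgebra.algebraMap_eq]
  · apply e.injective
    simp only [map_mul, map_add, e.apply_symm_apply]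
    ext <;> simp [CharTwo.neg_eq]
  · rw [canonicalInvolution_eq, reducedTrace_apply, e.apply_symm_apply, map_one]
  · rw [canonicalInvolution_eq, reducedTrace_apply, e.apply_symm_apply, map_zero, add_zero]
  · rw [map_eq_zero_iff _ e.symm.injective] at h
    exact one_ne_zero (congrArg QuaternionAlgebra.imJ h)
  · apply e.injective
    simp only [map_mul, map_add, map_smul, e.apply_symm_apply, map_one]
    ext <;> simp

/-- A hands-on Skolem–Noether argument: first find w intertwining the actions of u, then average
over v to intertwine the actions of v as well. -/
theorem exists_ne_zero_intertwines (θ : Involution F D) : ∃ s : D, s ≠ 0 ∧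
    ∀ x, θ.toFun x * s = s * (canonicalInvolution e).toFun x := by
  have : CharP D 2 := charP_of_injective_algebraMap (algebraMap F D).injective 2
  have hb := ne_zero_of_algEquiv_quaternionAlgebra e
  obtain ⟨u, v, hu, hv, hvu, hcu, hcv, hv0, hgen⟩ := exists_standard_generators e
  suffices h : ∃ s : D, s ≠ 0 ∧ θ.toFun u * s = s * (u + 1) ∧ θ.toFun v * s = s * v by
    obtain ⟨s, hs, hsu, hsv⟩ := h
    rw [← hcu] at hsu
    refine ⟨s, hs, fun x => ?_⟩
    have hsv' : θ.toFun v * s = s * (canonicalInvolution e).toFun v := by rw [hcv, hsv]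
    have huv : θ.toFun (u * v) * s = s * (canonicalInvolution e).toFun (u * v) := by
      rw [θ.map_mul', mul_assoc, hsu, ← mul_assoc, hsv', mul_assoc,
        (canonicalInvolution e).map_mul']
    obtain ⟨c₀, c₁, c₂, c₃, rfl⟩ := hgen x
    simp only [Involution.toFun_add, Involution.toFun_smul, Involution.toFun_one, add_mul, mul_add,
      smul_mul_assoc, mul_smul_comm, hsu, hsv', huv, one_mul, mul_one]
  obtain ⟨w, hw0, hwu⟩ : ∃ w : D, w ≠ 0 ∧ θ.toFun u * w = w * (u + 1) := by
    have huu : θ.toFun u * θ.toFun u = algebraMap F D a + θ.toFun u := by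
      rw [← θ.map_mul', hu, θ.toFun_add, θ.toFun_algebraMap]
    -- Both θ(u) and u are roots of X² + X = a, so this combination is an intertwiner for every z;
    -- if all of them vanished, z = 1 and z = v would give v = 0.
    have hw : ∀ z, θ.toFun u * (θ.toFun u * z + z * u) = (θ.toFun u * z + z * u) * (u + 1) := by
      intro z
      have hc := Algebra.commutes a z
      calc θ.toFun u * (θ.toFun u * z + z * u)
          = (θ.toFun u * θ.toFun u) * z + θ.toFun u * z * u := by noncomm_ring
        _ = θ.toFun u * z * u + θ.toFun u * z + z * (u * u) + z * u := by
            rw [huu, hu, mul_add, ← hc, add_assoc _ _ (z * u), add_assoc (_ * z) (z * u),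
              CharTwo.add_self_eq_zero]
            noncomm_ring
        _ = _ := by noncomm_ring
    by_contra! hcon
    have hz : ∀ z, θ.toFun u * z = z * u := fun z => by
      by_contra hne
      exact hcon _ (fun h0 => hne (CharTwo.add_eq_zero.1 h0)) (hw z)
    have h1 := hz 1
    rw [mul_one, one_mul] at h1
    have h3 := hz v
    rw [h1, hvu, right_eq_add] at h3
    exact hv0 h3
  have hvb : ∀ z, z * v * v = b • z := fun z => by
    rw [mul_assoc, hv, ← Algebra.commutes, Algebra.smul_def]
  have htb : ∀ z, θ.toFun v * (θ.toFun v * z) = b • z := fun z => by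
    rw [← mul_assoc, ← θ.map_mul', hv, θ.toFun_algebraMap, Algebra.smul_def]
  -- If the average vanishes, w equals its own transform in characteristic 2, so w itself already
  -- intertwines.
  by_cases hs : w + b⁻¹ • (θ.toFun v * w * v) = 0
  · refine ⟨w, hw0, hwu, ?_⟩
    rw [CharTwo.add_eq_zero] at hs
    have h3 := congrArg (· * v) hs
    simp only [smul_mul_assoc] at h3
    rw [hvb, smul_smul, inv_mul_cancel₀ hb, one_smul] at h3
    exact h3.symm
  · refine ⟨_, hs, ?_, ?_⟩
    · have h3 : θ.toFun u * θ.toFun v = θ.toFun v + θ.toFun v * θ.toFun u := by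
        rw [← θ.map_mul', hvu, θ.toFun_add, θ.map_mul']
      have h4 : v * (u + 1) = u * v := by
        rw [mul_add, hvu, mul_one, add_right_comm, CharTwo.add_self_eq_zero, zero_add]
      have h5 : θ.toFun u * (θ.toFun v * w * v) = θ.toFun v * w * v * (u + 1) := by
        calc θ.toFun u * (θ.toFun v * w * v) = (θ.toFun u * θ.toFun v) * w * v := by
              noncomm_ring
          _ = θ.toFun v * (w + θ.toFun u * w) * v := by rw [h3]; noncomm_ring
          _ = θ.toFun v * w * (u * v) := by
              rw [hwu, mul_add w, mul_one, add_left_comm, CharTwo.add_self_eq_zero, add_zero]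
              noncomm_ring
          _ = _ := by rw [← h4]; noncomm_ring
      rw [mul_add, add_mul, hwu, mul_smul_comm, smul_mul_assoc, h5]
    · rw [mul_add, add_mul, mul_smul_comm, smul_mul_assoc, hvb, mul_assoc (θ.toFun v), htb,
        smul_smul, smul_smul, inv_mul_cancel₀ hb, one_smul, one_smul, add_comm]

/-- Because θ and γ are both involutive, γ(s)s⁻¹ is central, so γ(s) = cs with c² = 1. In
characteristic 2 this leaves only c = 1. -/
theorem exists_symmetric_intertwines (hD : IsQuaternionAlgebra F D) (θ : Involution F D) :
    ∃ s : D, s ≠ 0 ∧ (∀ x, θ.toFun x * s = s * (canonicalInvolution e).toFun x) ∧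
      (canonicalInvolution e).toFun s = s := by
  obtain ⟨s, hs, hθ⟩ := exists_ne_zero_intertwines e θ
  refine ⟨s, hs, hθ, ?_⟩
  set γ := canonicalInvolution e
  have hc : ∀ x, γ.toFun s * s⁻¹ * x = x * (γ.toFun s * s⁻¹) := fun x => by
    have h1 := hθ (θ.toFun x)
    rw [θ.involutive'] at h1
    have h3 := congrArg γ.toFun (hθ x)
    rw [γ.map_mul', γ.map_mul', γ.involutive',
      (eq_inv_mul_iff_mul_eq₀ hs).2 h1.symm] at h3
    rw [← mul_assoc, ← h3]
    simp only [mul_assoc, mul_inv_cancel₀ hs, mul_one]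
  have hcen := hD.isCentral
  obtain ⟨c, hc'⟩ := (Algebra.IsCentral.mem_center_iff F).1
    (Subalgebra.mem_center_iff.2 fun x => (hc x).symm)
  have hsc : γ.toFun s = c • s := by
    rw [Algebra.smul_def, ← hc', inv_mul_cancel_right₀ hs]
  have h3 := congrArg γ.toFun hsc
  rw [γ.involutive', γ.toFun_smul, hsc, smul_smul] at h3
  have h4 : (1 - c * c) • s = 0 := by rw [sub_smul, one_smul, ← h3, sub_self]
  have h5 : (1 + c) ^ 2 = 0 := by
    have := (smul_eq_zero.1 h4).resolve_right hs
    linear_combination this + (c + c ^ 2) * (CharTwo.two_eq_zero : (2 : F) = 0)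
  have h6 : (1 : F) = c := CharTwo.add_eq_zero.1 (pow_eq_zero_iff two_ne_zero |>.1 h5)
  rw [hsc, ← h6, one_smul]

end SkolemNoether

/-! ### Diagonal hermitian and quadratic forms. -/

section Diagonal

variable {F D : Type*} [Field F] [DivisionRing D] [Algebra F D] (θ : Involution F D)
  {ι : Type*} [Fintype ι]

theorem Involution.toFun_sum (f : ι → D) : θ.toFun (∑ i, f i) = ∑ i, θ.toFun (f i) :=
  map_sum θ.toLinearMap f Finset.univ

/-- The diagonal hermitian form with symmetric coefficients `c i`. -/
def HermitianForm.diagonal (c : ι → D) (hc : ∀ i, θ.toFun (c i) = c i) :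
    HermitianForm θ (ι → D) where
  toFun x y := ∑ i, θ.toFun (x i) * c i * y i
  add_left x x' y := by
    simp only [Pi.add_apply, θ.toFun_add, add_mul, Finset.sum_add_distrib]
  add_right x y y' := by simp only [Pi.add_apply, mul_add, Finset.sum_add_distrib]
  smul_smul x y d₁ d₂ := by
    simp only [Pi.smul_apply, MulOpposite.smul_eq_mul_unop, MulOpposite.unop_op, θ.map_mul',
      Finset.mul_sum, Finset.sum_mul, mul_assoc]
  symm x y := by
    simp only [θ.toFun_sum, θ.map_mul', θ.involutive', hc, mul_assoc]

/-- The diagonal quadratic form with coefficients `c i + Alt(D, θ)`. -/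
def QuadForm.diagonal (c : ι → D) : QuadForm θ (ι → D) where
  toFun x := Submodule.Quotient.mk (∑ i, θ.toFun (x i) * c i * x i)
  polar := HermitianForm.diagonal θ (fun i => c i + θ.toFun (c i)) fun i => by
    rw [θ.toFun_add, θ.involutive', add_comm]
  map_smul x d := by
    rw [θ.quotSandwich_mk]
    simp only [Pi.smul_apply, MulOpposite.smul_eq_mul_unop, MulOpposite.unop_op, θ.map_mul',
      Finset.mul_sum, Finset.sum_mul, mul_assoc]
  map_add x y := by
    rw [← Submodule.Quotient.mk_sub, ← Submodule.Quotient.mk_sub, Submodule.Quotient.eq,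
      θ.mem_alt]
    refine ⟨∑ i, θ.toFun (y i) * c i * x i, ?_⟩
    rw [θ.toFun_sum]
    simp only [HermitianForm.diagonal, ← Finset.sum_sub_distrib]
    refine Finset.sum_congr rfl fun i _ => ?_
    simp only [Pi.add_apply, θ.toFun_add, θ.map_mul', θ.involutive']
    noncomm_ring

theorem HermitianForm.diagonal_nondegenerate [DecidableEq ι] {c : ι → D}
    (hc : ∀ i, θ.toFun (c i) = c i) (hc0 : ∀ i, c i ≠ 0) :
    (HermitianForm.diagonal θ c hc).Nondegenerate := by
  intro x hx
  ext i
  have h := hx (Pi.single i 1)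
  simp only [HermitianForm.diagonal] at h
  rw [Finset.sum_eq_single i (fun j _ hj => by rw [Pi.single_eq_of_ne hj, mul_zero])
    (fun h => absurd (Finset.mem_univ i) h), Pi.single_eq_same, mul_one, mul_eq_zero] at h
  by_contra hne
  exact θ.toFun_ne_zero hne (h.resolve_right (hc0 i))

theorem finrank_mulOpposite_fun (n : ℕ) : finrank Dᵐᵒᵖ (Fin n → D) = n := by
  have h1 : finrank Dᵐᵒᵖ D = 1 :=
    finrank_eq_one (1 : D) one_ne_zero fun w => ⟨MulOpposite.op w, by simp⟩
  have : Module.Finite Dᵐᵒᵖ D := finite_of_finrank_pos (by omega)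
  rw [finrank_pi_fintype, h1]
  simp

theorem uTilde_le_uQuad : uTilde θ ≤ uQuad θ := by
  refine sSup_le_sSup ?_
  rintro n ⟨V, _, _, hV, q, ha, -, hn⟩
  exact ⟨V, _, _, hV, q, ha, hn⟩

end Diagonal

/-! ### Anisotropic forms of dimension 2 and 3. -/

section LowerBounds

variable {F : Type*} {D : Type*} [Field F] [CharP F 2] [DivisionRing D] [Algebra F D] {a b : F}
  (e : D ≃ₐ[F] ℍ[F, a, 1, b])

/-- Multiplying by x on the left and γ(x) on the right turns the equation into N(x)²c = fN(x). -/
theorem eq_algebraMap_of_sandwich_eq {c x : D} (hx : x ≠ 0) {f : F}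
    (h : (canonicalInvolution e).toFun x * c * x = algebraMap F D f) :
    c = algebraMap F D (f * (reducedNorm e x)⁻¹) := by
  have hN : reducedNorm e x ≠ 0 := fun h => hx ((reducedNorm_eq_zero_iff e).1 h)
  have h3 : algebraMap F D (reducedNorm e x) * c * algebraMap F D (reducedNorm e x) =
      algebraMap F D (f * reducedNorm e x) := by
    have h4 : x * ((canonicalInvolution e).toFun x * c * x) * (canonicalInvolution e).toFun x =
        (x * (canonicalInvolution e).toFun x) * c * (x * (canonicalInvolution e).toFun x) := by
      noncomm_ring
    rw [← mul_canonicalInvolution_self, ← h4, h, ← Algebra.commutes, mul_assoc,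
      mul_canonicalInvolution_self, map_mul]
  rw [mul_assoc, ← Algebra.commutes, ← mul_assoc, ← map_mul, ← Algebra.smul_def] at h3
  rw [← inv_smul_smul₀ (mul_ne_zero hN hN) c, h3, Algebra.smul_def, ← map_mul]
  congr 1
  field_simp

theorem two_le_uPlus_canonicalInvolution : 2 ≤ uPlus (canonicalInvolution e) := by
  obtain ⟨c, hc, hcF⟩ : ∃ c : D, reducedTrace e c = 0 ∧ ∀ f : F, c ≠ algebraMap F D f := by
    -- The generator v has trace 0 and lies outside F.
    refine ⟨e.symm ⟨0, 0, 1, 0⟩, ?_, fun f h => ?_⟩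
    · rw [reducedTrace_apply, e.apply_symm_apply]
    · rw [e.symm_apply_eq, e.commutes] at h
      exact one_ne_zero (congrArg QuaternionAlgebra.imJ h)
  refine le_sSup ⟨Fin 2 → D, inferInstance, inferInstance, ?_,
    HermitianForm.diagonal _ ![1, c] ?_, ?_, ?_⟩
  · exact finite_of_finrank_pos (by rw [finrank_mulOpposite_fun]; norm_num)
  · intro i
    fin_cases i
    · exact Involution.toFun_one _
    · exact (canonicalInvolution_eq_self_iff e).2 hc
  · intro x hx h
    simp only [HermitianForm.diagonal, Fin.sum_univ_two, Matrix.cons_val_zero, mul_one,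
      Matrix.cons_val_one, canonicalInvolution_mul_self] at h
    rw [add_comm, add_eq_zero_iff_eq_neg, ← map_neg] at h
    by_cases h1 : x 1 = 0
    · rw [h1, mul_zero, eq_comm, map_eq_zero, neg_eq_zero, reducedNorm_eq_zero_iff] at h
      exact hx (by ext i; fin_cases i <;> assumption)
    · exact hcF _ (eq_algebraMap_of_sandwich_eq e h1 h)
  · rw [finrank_mulOpposite_fun]; rfl

theorem exists_reducedTrace_one_sum_reducedNorm_eq_zero : ∃ c : Fin 3 → D,
    (∀ i, reducedTrace e (c i) = 1) ∧
      reducedNorm e (c 0) + reducedNorm e (c 1) + reducedNorm e (c 2) = 0 := by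
  have hb := ne_zero_of_algEquiv_quaternionAlgebra e
  have h2 : (2 : F) = 0 := CharTwo.two_eq_zero
  -- With third coefficient z in the first two elements, the norms sum to a + b + bz; the value z =
  -- a/b + 1 makes this 0.
  refine ⟨![e.symm ⟨0, 1, 1, a / b + 1⟩, e.symm ⟨0, 1, 0, a / b + 1⟩, e.symm ⟨0, 1, 0, 0⟩],
    fun i => ?_, ?_⟩
  · fin_cases i <;> exact congrArg QuaternionAlgebra.imI (e.apply_symm_apply _)
  · simp only [reducedNorm, Matrix.cons_val, e.apply_symm_apply, QuaternionAlgebra.re_mul,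
      QuaternionAlgebra.re_star, QuaternionAlgebra.imI_star, QuaternionAlgebra.imJ_star,
      QuaternionAlgebra.imK_star]
    have h : b * (a / b + 1) = a + b := by field_simp
    generalize a / b + 1 = c at h
    ring_nf
    linear_combination -h + (a * b * c ^ 2 - 2 * a - b) * h2

theorem reducedNorm_sandwich (x c : D) :
    reducedNorm e ((canonicalInvolution e).toFun x * c * x) =
      reducedNorm e x ^ 2 * reducedNorm e c := by
  rw [reducedNorm_mul, reducedNorm_mul, reducedNorm_canonicalInvolution]
  ring

theorem reducedTrace_sandwich (x c : D) :
    reducedTrace e ((canonicalInvolution e).toFun x * c * x) =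
      reducedNorm e x * reducedTrace e c := by
  rw [mul_assoc, reducedTrace_mul_comm, mul_assoc, mul_canonicalInvolution_self,
    ← Algebra.commutes, ← Algebra.smul_def, map_smul, smul_eq_mul]

/-- The reduced norm of a value of trace `1` of a binary form `⟨c, d⟩` with `c`, `d` of trace `1`
is not congruent to the discriminant of the form. -/
theorem reducedNorm_binary_ne {c d x y : D} (hc : reducedTrace e c = 1)
    (hd : reducedTrace e d = 1) (hxy : reducedNorm e x + reducedNorm e y = 1) (f : F) :
    reducedNorm e ((canonicalInvolution e).toFun x * c * x +
      (canonicalInvolution e).toFun y * d * y) + reducedNorm e c + reducedNorm e d ≠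
      f ^ 2 + f := by
  have h2 : (2 : F) = 0 := CharTwo.two_eq_zero
  set γ := canonicalInvolution e
  by_cases hy : reducedNorm e y = 0
  · rw [reducedNorm_eq_zero_iff] at hy
    subst hy
    have h0 : reducedNorm e (0 : D) = 0 := (reducedNorm_eq_zero_iff e).2 rfl
    rw [h0, add_zero] at hxy
    rw [mul_zero, add_zero, reducedNorm_sandwich, hxy]
    convert reducedNorm_ne_of_reducedTrace_eq_one e hd f using 1
    linear_combination reducedNorm e c * h2
  -- The element N(y)c + N(y)⁻¹γ(w)dw has trace N(y) + N(x) = 1. Its norm is the left side of the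
  -- claim, since N(x)² + 1 = N(y)² and the two cross terms agree by cyclicity of the trace.
  · set w := y * γ.toFun x with hw
    have hNw : reducedNorm e w = reducedNorm e x * reducedNorm e y := by
      rw [hw, reducedNorm_mul, reducedNorm_canonicalInvolution, mul_comm]
    have hz := reducedNorm_ne_of_reducedTrace_eq_one e (x := reducedNorm e y • c +
      (reducedNorm e y)⁻¹ • (γ.toFun w * d * w)) (by
        rw [map_add, map_smul, map_smul, reducedTrace_sandwich, hc, hd, hNw]
        simp only [smul_eq_mul]
        field_simp
        linear_combination hxy) f
    convert hz using 1
    rw [reducedNorm_add, reducedNorm_add, reducedNorm_smul, reducedNorm_smul,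
      reducedNorm_sandwich, reducedNorm_sandwich, reducedNorm_sandwich, hNw]
    have h3 : reducedTrace e (γ.toFun (γ.toFun x * c * x) * (γ.toFun y * d * y)) =
        reducedTrace e (γ.toFun c * (γ.toFun w * d * w)) := by
      rw [γ.map_mul', γ.map_mul', γ.involutive', hw, γ.map_mul', γ.involutive']
      rw [mul_assoc (γ.toFun x), reducedTrace_mul_comm]
      simp only [mul_assoc]
    rw [h3, γ.toFun_smul, smul_mul_smul_comm, mul_inv_cancel₀ hy, one_smul]
    have h4 : reducedNorm e x = 1 + reducedNorm e y := by
      linear_combination hxy - reducedNorm e y * h2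
    field_simp
    rw [h4]
    linear_combination (reducedNorm e c + reducedNorm e y * reducedNorm e c -
      reducedNorm e y * reducedNorm e d) * h2

/-- A ternary diagonal form with coefficients of trace `1` and trivial discriminant is
anisotropic. -/
theorem eq_zero_of_ternary_eq_algebraMap {c : Fin 3 → D} (hc : ∀ i, reducedTrace e (c i) = 1)
    (hN : reducedNorm e (c 0) + reducedNorm e (c 1) + reducedNorm e (c 2) = 0) {x : Fin 3 → D}
    {f : F} (h : ∑ i, (canonicalInvolution e).toFun (x i) * c i * x i = algebraMap F D f) :
    x = 0 := by
  have h2 : (2 : F) = 0 := CharTwo.two_eq_zero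
  have : CharP D 2 := charP_of_injective_algebraMap (algebraMap F D).injective 2
  set γ := canonicalInvolution e with hγ
  rw [Fin.sum_univ_three] at h
  have hscale : ∀ (y z d : D), γ.toFun (y * z) * d * (y * z) =
      γ.toFun z * (γ.toFun y * d * y) * z := fun y z d => by
    rw [γ.map_mul']; noncomm_ring
  have hinv : ∀ (y d : D), y ≠ 0 → γ.toFun y⁻¹ * (γ.toFun y * d * y) * y⁻¹ = d := fun y d hy => by
    rw [← hscale, mul_inv_cancel₀ hy, γ.toFun_one, one_mul, mul_one]
  have hF : ∀ (y : D) (f : F), γ.toFun y * algebraMap F D f * y =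
      algebraMap F D (f * reducedNorm e y) := fun y f => by
    rw [← Algebra.commutes, mul_assoc, canonicalInvolution_mul_self, map_mul]
  have hNadd : ∀ (i : Fin 3) (g : F), reducedNorm e (c i + algebraMap F D g) =
      reducedNorm e (c i) + (g ^ 2 + g) := fun i g => by
    rw [reducedNorm_add, reducedNorm_algebraMap, ← Algebra.commutes, ← Algebra.smul_def, map_smul,
      reducedTrace_canonicalInvolution, hc, smul_eq_mul]
    ring
  by_cases hx2 : x 2 = 0
  · by_cases hx1 : x 1 = 0
    · rw [hx1, hx2, mul_zero, mul_zero, add_zero, add_zero] at h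
      have ht := congrArg (reducedTrace e) h
      rw [reducedTrace_sandwich, reducedTrace_algebraMap, hc, mul_one,
        reducedNorm_eq_zero_iff] at ht
      ext i
      fin_cases i <;> assumption
    · exfalso
      rw [hx2, mul_zero, add_zero] at h
      -- Dividing by x₁ and comparing traces gives N(y) = 1; comparing norms then makes N(c₂) = g² +
      -- g, although c₂ has trace 1.
      obtain ⟨y, g, hy⟩ : ∃ (y : D) (g : F), γ.toFun y * c 0 * y = c 1 + algebraMap F D g := by
        refine ⟨x 0 * (x 1)⁻¹, f * reducedNorm e (x 1)⁻¹, ?_⟩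
        have h' := congrArg (fun z => γ.toFun (x 1)⁻¹ * z * (x 1)⁻¹) h
        simp only [mul_add, add_mul] at h'
        rw [hinv _ _ hx1, hF, ← hscale] at h'
        rw [← h', add_left_comm, CharTwo.add_self_eq_zero, add_zero]
      have ht := congrArg (reducedTrace e) hy
      have hn := congrArg (reducedNorm e) hy
      rw [reducedTrace_sandwich, map_add, reducedTrace_algebraMap, hc, hc, mul_one,
        add_zero] at ht
      rw [reducedNorm_sandwich, ht, hNadd] at hn
      refine reducedNorm_ne_of_reducedTrace_eq_one e (hc 2) g ?_
      linear_combination hN - hn - (reducedNorm e (c 1) + g ^ 2 + g) * h2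
  · exfalso
    -- After division by x₂, the binary form ⟨c₀, c₁⟩ represents c₂ + g. Its norm plus N(c₀) + N(c₁)
    -- is g² + g, which `reducedNorm_binary_ne` forbids.
    obtain ⟨y, z, g, hy⟩ : ∃ (y z : D) (g : F), γ.toFun y * c 0 * y + γ.toFun z * c 1 * z =
        c 2 + algebraMap F D g := by
      refine ⟨x 0 * (x 2)⁻¹, x 1 * (x 2)⁻¹, f * reducedNorm e (x 2)⁻¹, ?_⟩
      have h' := congrArg (fun z => γ.toFun (x 2)⁻¹ * z * (x 2)⁻¹) h
      simp only [mul_add, add_mul] at h'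
      rw [hinv _ _ hx2, hF, ← hscale, ← hscale] at h'
      rw [← h', add_left_comm, CharTwo.add_self_eq_zero, add_zero]
    have ht := congrArg (reducedTrace e) hy
    have hn := congrArg (reducedNorm e) hy
    rw [map_add, reducedTrace_sandwich, reducedTrace_sandwich, map_add, reducedTrace_algebraMap,
      hc, hc, hc, mul_one, mul_one, add_zero] at ht
    rw [hNadd] at hn
    refine reducedNorm_binary_ne e (hc 0) (hc 1) ht g ?_
    linear_combination hN + hn

theorem three_le_uTilde_canonicalInvolution : 3 ≤ uTilde (canonicalInvolution e) := by
  obtain ⟨c, hc, hN⟩ := exists_reducedTrace_one_sum_reducedNorm_eq_zero e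
  refine le_sSup ⟨Fin 3 → D, inferInstance, inferInstance, ?_,
    QuadForm.diagonal _ c, ?_, ?_, ?_⟩
  · exact finite_of_finrank_pos (by rw [finrank_mulOpposite_fun]; norm_num)
  · intro x hx h
    refine hx ?_
    have h' := (Submodule.Quotient.mk_eq_zero _).1 h
    obtain ⟨f, hf⟩ := (mem_alt_canonicalInvolution e).1 h'
    exact eq_zero_of_ternary_eq_algebraMap e hc hN hf.symm
  · refine HermitianForm.diagonal_nondegenerate _
      (fun i => by rw [Involution.toFun_add, Involution.involutive', add_comm]) fun i => ?_
    rw [add_canonicalInvolution, hc, map_one]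
    exact one_ne_zero
  · rw [finrank_mulOpposite_fun]; rfl

end LowerBounds

/-! ### Isotropy in larger dimensions. -/

section UpperBounds

variable {F : Type*} {D : Type*} [Field F] [DivisionRing D] [Algebra F D] {a b : F}

/-- The two coordinates of an element of a quaternion algebra that vanish on the maximal subfield
generated by the first standard generator. -/
def coordJK (e : D ≃ₐ[F] ℍ[F, a, 1, b]) : Fin 2 → D →ₗ[F] F :=
  ![(QuaternionAlgebra.imJₗ a 1 b).comp e.toLinearMap,
    (QuaternionAlgebra.imKₗ a 1 b).comp e.toLinearMap]

/-- The constant coordinate of an element of a quaternion algebra. -/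
def coordOne (e : D ≃ₐ[F] ℍ[F, a, 1, b]) : D →ₗ[F] F :=
  (QuaternionAlgebra.reₗ a 1 b).comp e.toLinearMap

variable (e : D ≃ₐ[F] ℍ[F, a, 1, b])

theorem coordJK_algebraMap (i : Fin 2) (c : F) : coordJK e i (algebraMap F D c) = 0 := by
  fin_cases i
  · change (e (algebraMap F D c)).imJ = 0
    rw [e.commutes]; rfl
  · change (e (algebraMap F D c)).imK = 0
    rw [e.commutes]; rfl

theorem coordOne_algebraMap (c : F) : coordOne e (algebraMap F D c) = c := by
  change (e (algebraMap F D c)).re = c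
  rw [e.commutes]; rfl

theorem eq_algebraMap_coordOne {x : D} (hT : reducedTrace e x = 0)
    (hJK : ∀ i, coordJK e i x = 0) : x = algebraMap F D (coordOne e x) :=
  mem_range_algebraMap_of_coords e hT (hJK 0) (hJK 1)

theorem sandwich_smul (c d : D) (r : F) :
    (canonicalInvolution e).toFun (r • d) * c * (r • d) =
      r ^ 2 • ((canonicalInvolution e).toFun d * c * d) := by
  rw [Involution.toFun_smul, smul_mul_assoc, smul_mul_smul_comm, sq]

variable {V : Type*} [AddCommGroup V] [Module Dᵐᵒᵖ V]

theorem QuadForm.toFun_smul_eq_mk (q : QuadForm (canonicalInvolution e) V) {x : V} {c : D} (hc : Submodule.Quotient.mk c = q.toFun x)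
    (d : D) : q.toFun (MulOpposite.op d • x) =
      Submodule.Quotient.mk ((canonicalInvolution e).toFun d * c * d) := by
  rw [q.map_smul, ← hc, Involution.quotSandwich_mk, mul_assoc]

section CharTwo

variable [CharP F 2]

theorem HermitianForm.toFun_add_self (h : HermitianForm (canonicalInvolution e) V) (x y : V) :
    h.toFun (x + y) (x + y) = h.toFun x x + h.toFun y y +
      algebraMap F D (reducedTrace e (h.toFun x y)) := by
  rw [← add_canonicalInvolution, ← h.symm, h.add_left, h.add_right, h.add_right]
  abel

theorem HermitianForm.reducedTrace_toFun_self (h : HermitianForm (canonicalInvolution e) V)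
    (x : V) : reducedTrace e (h.toFun x x) = 0 :=
  (canonicalInvolution_eq_self_iff e).1 (h.symm x x).symm

/-- The cross terms are exchanged by γ, so they add up to a reduced trace: d ↦ γ(d)cd is additive
modulo F, hence Frobenius-semilinear in the coordinates that vanish on F. -/
theorem sandwich_add {c : D} (hc : reducedTrace e c = 0) (d d' : D) :
    (canonicalInvolution e).toFun (d + d') * c * (d + d') =
      (canonicalInvolution e).toFun d * c * d + (canonicalInvolution e).toFun d' * c * d' +
        algebraMap F D (reducedTrace e ((canonicalInvolution e).toFun d * c * d')) := by
  rw [← add_canonicalInvolution, Involution.map_mul', Involution.map_mul',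
    Involution.involutive', (canonicalInvolution_eq_self_iff e).2 hc, Involution.toFun_add]
  noncomm_ring

/-- Binary totally singular quadratic forms over a quaternion algebra are isotropic. -/
theorem exists_binary_eq_algebraMap (hD : IsQuaternionAlgebra F D) (hF : DegreeOverSquaresEq F 2)
    {c d : D} (hc : reducedTrace e c = 0) (hd : reducedTrace e d = 0) :
    ∃ p : D × D, p ≠ 0 ∧ ∃ f : F, (canonicalInvolution e).toFun p.1 * c * p.1 +
      (canonicalInvolution e).toFun p.2 * d * p.2 = algebraMap F D f := by
  have hfin : FiniteDimensional F D := finite_of_finrank_pos (by rw [hD.finrank_eq]; norm_num)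
  -- The space has F-dimension 8 and the two coordinates cost at most 4, so a nonzero vector
  -- survives.
  obtain ⟨W, hW, hW'⟩ := exists_submodule_of_frobenius_semilinear (V := D × D) hF
    (fun i p => coordJK e i ((canonicalInvolution e).toFun p.1 * c * p.1 +
      (canonicalInvolution e).toFun p.2 * d * p.2))
    (fun i p p' => by
      simp only [Prod.fst_add, Prod.snd_add, sandwich_add e hc, sandwich_add e hd, map_add,
        coordJK_algebraMap, add_zero]
      ring)
    (fun i r p => by
      simp only [Prod.smul_fst, Prod.smul_snd, sandwich_smul, ← smul_add, map_smul, smul_eq_mul])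
  rw [finrank_prod, hD.finrank_eq] at hW
  obtain ⟨p, hp, hp0⟩ := exists_mem_notMem_of_finrank_lt (F := F) (U := W) (W := ⊥)
    (by rw [finrank_bot]; omega)
  refine ⟨p, hp0, _, eq_algebraMap_coordOne e ?_ (hW' p hp)⟩
  rw [map_add, reducedTrace_sandwich, reducedTrace_sandwich, hc, hd, mul_zero, mul_zero, add_zero]

variable (q : QuadForm (canonicalInvolution e) V)

/-- Since x + x = 0, the polar identity at (x, x) says that h(x, x) is −2q(x) = 0 modulo Alt. -/
theorem QuadForm.exists_polar_self_eq_algebraMap (x : V) :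
    ∃ f : F, algebraMap F D f = q.polar.toFun x x := by
  have : CharP D 2 := charP_of_injective_algebraMap (algebraMap F D).injective 2
  obtain ⟨c, hc⟩ := Submodule.Quotient.mk_surjective _ (q.toFun x)
  rw [← mem_alt_canonicalInvolution e, ← Submodule.Quotient.mk_eq_zero, ← q.map_add]
  have hx : x + x = MulOpposite.op (0 : D) • x := by
    have h : (MulOpposite.op (1 + 1 : D)) • x = x + x := by
      rw [MulOpposite.op_add, MulOpposite.op_one, add_smul, one_smul]
    rw [← h, CharTwo.add_self_eq_zero]
  rw [hx, q.toFun_smul_eq_mk e hc, ← hc, ← Submodule.Quotient.mk_sub, ← Submodule.Quotient.mk_sub,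
    mul_zero, zero_sub, CharTwo.neg_eq, sub_self, Submodule.Quotient.mk_zero]

/-- As h vanishes on the line xD, q is additive there. Comparing q at x, xv and x(1 + v) gives vc +
cv ∈ F, and then Trd(c)v ∈ F, which forces Trd(c) = 0 because v ∉ F. -/
theorem QuadForm.reducedTrace_eq_zero_of_polar_self {x : V} (hx : q.polar.toFun x x = 0) {c : D}
    (hc : Submodule.Quotient.mk c = q.toFun x) : reducedTrace e c = 0 := by
  have : CharP D 2 := charP_of_injective_algebraMap (algebraMap F D).injective 2
  obtain ⟨v, hv, hv'⟩ : ∃ v : D, reducedTrace e v = 0 ∧ coordJK e 0 v = 1 := by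
    refine ⟨e.symm ⟨0, 0, 1, 0⟩, ?_, ?_⟩
    · rw [reducedTrace_apply, e.apply_symm_apply]
    · exact congrArg QuaternionAlgebra.imJ (e.apply_symm_apply _)
  have hγv : (canonicalInvolution e).toFun v = v := (canonicalInvolution_eq_self_iff e).2 hv
  have h1 := q.map_add x (MulOpposite.op v • x)
  have h2 : x + MulOpposite.op v • x = MulOpposite.op (1 + v) • x := by
    rw [MulOpposite.op_add, MulOpposite.op_one, add_smul, one_smul]
  have h3 := q.polar.smul_smul x x 1 v
  rw [MulOpposite.op_one, one_smul, hx, mul_zero, zero_mul] at h3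
  rw [h3, h2, q.toFun_smul_eq_mk e hc, q.toFun_smul_eq_mk e hc, ← hc,
    ← Submodule.Quotient.mk_sub, ← Submodule.Quotient.mk_sub, Submodule.Quotient.mk_zero,
    Submodule.Quotient.mk_eq_zero, mem_alt_canonicalInvolution, Involution.toFun_add,
    Involution.toFun_one, hγv] at h1
  obtain ⟨f, hf⟩ := h1
  have h4 : algebraMap F D f = v * c + c * v := by rw [hf]; noncomm_ring
  have h5 := add_canonicalInvolution e (v * c)
  rw [Involution.map_mul', hγv, canonicalInvolution_eq, add_mul, ← add_assoc, ← h4,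
    ← Algebra.smul_def] at h5
  have h6 := congrArg (coordJK e 0) h5
  rw [_root_.map_add, _root_.map_smul, coordJK_algebraMap,
    coordJK_algebraMap, hv', zero_add, smul_eq_mul, mul_one] at h6
  exact h6

end CharTwo

variable [Module F V] [IsScalarTower F Dᵐᵒᵖ V]

theorem op_algebraMap_smul (c : F) (x : V) : MulOpposite.op (algebraMap F D c) • x = c • x := by
  rw [← MulOpposite.algebraMap_apply, algebraMap_smul]

theorem HermitianForm.toFun_smul_left {θ : Involution F D} (h : HermitianForm θ V) (c : F)
    (x y : V) : h.toFun (c • x) y = c • h.toFun x y := by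
  have := h.smul_smul x y (algebraMap F D c) 1
  rwa [op_algebraMap_smul, MulOpposite.op_one, one_smul, θ.toFun_algebraMap, mul_one,
    ← Algebra.smul_def] at this

theorem HermitianForm.toFun_smul_right {θ : Involution F D} (h : HermitianForm θ V) (c : F)
    (x y : V) : h.toFun x (c • y) = c • h.toFun x y := by
  have := h.smul_smul x y 1 (algebraMap F D c)
  rwa [op_algebraMap_smul, MulOpposite.op_one, one_smul, θ.toFun_one, one_mul,
    ← Algebra.commutes, ← Algebra.smul_def] at this

theorem finrank_eq_four_mul (hD : IsQuaternionAlgebra F D) :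
    finrank F V = 4 * finrank Dᵐᵒᵖ V := by
  have h4 : finrank F Dᵐᵒᵖ = 4 := by
    rw [← (MulOpposite.opLinearEquiv F : D ≃ₗ[F] Dᵐᵒᵖ).finrank_eq, hD.finrank_eq]; norm_num
  rw [← finrank_mul_finrank F Dᵐᵒᵖ V, h4]

variable [CharP F 2]

/-- The quadratic form over `F` sending `x` to the constant coordinate of `h(x, x)`. -/
def HermitianForm.coordOneForm (h : HermitianForm (canonicalInvolution e) V) :
    QuadraticForm F V :=
  have hp : ∀ x y, QuadraticMap.polar (fun x => coordOne e (h.toFun x x)) x y =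
      reducedTrace e (h.toFun x y) := fun x y => by
    rw [QuadraticMap.polar, h.toFun_add_self, map_add, map_add, coordOne_algebraMap]
    ring
  QuadraticMap.ofPolar (fun x => coordOne e (h.toFun x x))
    (fun c x => by
      rw [h.toFun_smul_left, h.toFun_smul_right, _root_.smul_smul, map_smul])
    (fun x x' y => by rw [hp, hp, hp, h.add_left, map_add])
    (fun c x y => by rw [hp, hp, h.toFun_smul_left, map_smul])

/-- If `h(x, x) ∈ F` on an `F`-subspace of dimension at least `5`, then `h` is isotropic on it. -/
theorem HermitianForm.exists_mem_isotropic [FiniteDimensional F V]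
    (hF : DegreeOverSquaresEq F 2) (h : HermitianForm (canonicalInvolution e) V)
    {W : Submodule F V} (hW : 5 ≤ finrank F W) (hWh : ∀ x ∈ W, ∀ i, coordJK e i (h.toFun x x) = 0) :
    ∃ x ∈ W, x ≠ 0 ∧ h.toFun x x = 0 := by
  obtain ⟨x, hx0, hx⟩ := exists_isotropic_of_five_le_finrank hF
    ((h.coordOneForm e).comp W.subtype) hW
  refine ⟨x, x.2, by simpa using hx0, ?_⟩
  have hx' : coordOne e (h.toFun x x) = 0 := hx
  rw [eq_algebraMap_coordOne e (h.reducedTrace_toFun_self e x) (hWh x x.2), hx', map_zero]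

/-- The F-dimension is at least 12; making h(x, x) central costs at most 4, and the remaining 8
exceeds the 5 needed. -/
theorem HermitianForm.exists_isotropic [FiniteDimensional F V] (hD : IsQuaternionAlgebra F D)
    (hF : DegreeOverSquaresEq F 2) (h : HermitianForm (canonicalInvolution e) V)
    (hV : 3 ≤ finrank Dᵐᵒᵖ V) : ∃ x ≠ 0, h.toFun x x = 0 := by
  obtain ⟨W, hW, hW'⟩ := exists_submodule_of_frobenius_semilinear hF
    (fun i x => coordJK e i (h.toFun x x))
    (fun i x y => by
      rw [h.toFun_add_self, map_add, map_add, coordJK_algebraMap, add_zero])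
    (fun i c x => by
      rw [h.toFun_smul_left, h.toFun_smul_right, _root_.smul_smul, map_smul, smul_eq_mul, sq])
  rw [finrank_eq_four_mul (V := V) hD] at hW
  obtain ⟨x, -, hx⟩ := h.exists_mem_isotropic e hF (by omega : 5 ≤ finrank F W) hW'
  exact ⟨x, hx⟩

theorem QuadForm.exists_isotropic [FiniteDimensional F V] (hD : IsQuaternionAlgebra F D)
    (q : QuadForm (canonicalInvolution e) V) (hF : DegreeOverSquaresEq F 2) (hV : 4 ≤ finrank Dᵐᵒᵖ V) : ∃ x ≠ 0, q.toFun x = 0 := by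
  have hfin : FiniteDimensional F D := finite_of_finrank_pos (by rw [hD.finrank_eq]; norm_num)
  have hdim := finrank_eq_four_mul (V := V) hD
  have hpol : ∀ x i, coordJK e i (q.polar.toFun x x) = 0 := fun x i => by
    obtain ⟨f, hf⟩ := q.exists_polar_self_eq_algebraMap e x
    rw [← hf, coordJK_algebraMap]
  obtain ⟨x, -, hx0, hx⟩ := q.polar.exists_mem_isotropic e hF (W := ⊤)
    (by rw [finrank_top]; omega) (fun x _ => hpol x)
  let orth : V →ₗ[F] D :=
    { toFun := q.polar.toFun x
      map_add' := q.polar.add_right x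
      map_smul' := fun c y => q.polar.toFun_smul_right c x y }
  let line : D →ₗ[F] V :=
    { toFun := fun d => MulOpposite.op d • x
      map_add' := fun d d' => by rw [MulOpposite.op_add, add_smul]
      map_smul' := fun c d => by
        rw [MulOpposite.op_smul, smul_assoc, RingHom.id_apply] }
  -- Searching for y inside an F-complement of xD keeps it independent of x over D. Orthogonality to
  -- x and avoidance of xD cost at most 4 dimensions each out of at least 16.
  obtain ⟨C, hC⟩ := Submodule.exists_isCompl (LinearMap.range line)
  have hd1 := Submodule.finrank_add_eq_of_isCompl hC
  have hd2 := line.finrank_range_le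
  have hd3 := orth.finrank_range_add_finrank_ker
  have hd4 := Submodule.finrank_le (LinearMap.range orth)
  have hd5 := Submodule.finrank_sup_add_finrank_inf_eq (LinearMap.ker orth) C
  have hd6 := Submodule.finrank_le (LinearMap.ker orth ⊔ C)
  rw [hD.finrank_eq] at hd2 hd4
  obtain ⟨y, ⟨hyo, hyC⟩, hy0, hy⟩ := q.polar.exists_mem_isotropic e hF
    (W := LinearMap.ker orth ⊓ C) (by omega) (fun x _ => hpol x)
  have hxy : q.polar.toFun x y = 0 := hyo
  obtain ⟨c, hc⟩ := Submodule.Quotient.mk_surjective _ (q.toFun x)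
  obtain ⟨d, hd⟩ := Submodule.Quotient.mk_surjective _ (q.toFun y)
  -- On the span of x and y the polar form vanishes, so q is diagonal with trace-0 coefficients
  -- there.
  obtain ⟨p, hp0, f, hf⟩ := exists_binary_eq_algebraMap e hD hF
    (q.reducedTrace_eq_zero_of_polar_self e hx hc) (q.reducedTrace_eq_zero_of_polar_self e hy hd)
  refine ⟨MulOpposite.op p.1 • x + MulOpposite.op p.2 • y, fun h0 => hp0 ?_, ?_⟩
  · have hp2 : p.2 = 0 := by
      by_contra hne
      refine hy0 ((Submodule.disjoint_def.1 hC.disjoint) y ⟨-(p.1 * p.2⁻¹), ?_⟩ hyC)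
      change MulOpposite.op (-(p.1 * p.2⁻¹)) • x = y
      have h1 := congrArg (fun z => MulOpposite.op p.2⁻¹ • z) h0
      simp only [smul_add, smul_smul, ← MulOpposite.op_mul, mul_inv_cancel₀ hne, smul_zero,
        MulOpposite.op_one, one_smul] at h1
      rw [MulOpposite.op_neg, neg_smul]
      exact (eq_neg_of_add_eq_zero_right h1).symm
    rw [hp2, MulOpposite.op_zero, zero_smul, add_zero, smul_eq_zero,
      MulOpposite.op_eq_zero_iff] at h0
    exact Prod.ext (h0.resolve_right hx0) hp2
  · have h1 := q.map_add (MulOpposite.op p.1 • x) (MulOpposite.op p.2 • y)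
    rw [q.polar.smul_smul, hxy, mul_zero, zero_mul, Submodule.Quotient.mk_zero, sub_sub,
      sub_eq_zero, q.toFun_smul_eq_mk e hc, q.toFun_smul_eq_mk e hd, ← Submodule.Quotient.mk_add,
      hf] at h1
    rw [h1, Submodule.Quotient.mk_eq_zero, mem_alt_canonicalInvolution]
    exact ⟨f, rfl⟩

theorem uPlus_canonicalInvolution_le (hD : IsQuaternionAlgebra F D)
    (hF : DegreeOverSquaresEq F 2) : uPlus (canonicalInvolution e) ≤ 2 := by
  refine sSup_le ?_
  rintro n ⟨V, _, _, hV, h, ha, rfl⟩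
  by_contra hn
  have hn' : 3 ≤ finrank Dᵐᵒᵖ V := by
    by_contra hlt
    exact hn (by exact_mod_cast (by omega : finrank Dᵐᵒᵖ V ≤ 2))
  let _ : Module F V := Module.compHom V (algebraMap F Dᵐᵒᵖ)
  have : IsScalarTower F Dᵐᵒᵖ V := IsScalarTower.of_algebraMap_smul fun _ _ => rfl
  have : FiniteDimensional F V :=
    finite_of_finrank_pos (by rw [finrank_eq_four_mul hD]; omega)
  obtain ⟨x, hx0, hx⟩ := h.exists_isotropic e hD hF hn'
  exact ha x hx0 hx

theorem uQuad_canonicalInvolution_le (hD : IsQuaternionAlgebra F D)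
    (hF : DegreeOverSquaresEq F 2) : uQuad (canonicalInvolution e) ≤ 3 := by
  refine sSup_le ?_
  rintro n ⟨V, _, _, hV, q, ha, rfl⟩
  by_contra hn
  have hn' : 4 ≤ finrank Dᵐᵒᵖ V := by
    by_contra hlt
    exact hn (by exact_mod_cast (by omega : finrank Dᵐᵒᵖ V ≤ 3))
  let _ : Module F V := Module.compHom V (algebraMap F Dᵐᵒᵖ)
  have : IsScalarTower F Dᵐᵒᵖ V := IsScalarTower.of_algebraMap_smul fun _ _ => rfl
  have : FiniteDimensional F V :=
    finite_of_finrank_pos (by rw [finrank_eq_four_mul hD]; omega)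
  obtain ⟨x, hx0, hx⟩ := q.exists_isotropic e hD hF hn'
  exact ha x hx0 hx

end UpperBounds

/-- Scaling by s⁻¹ carries the upper bounds from γ to θ, and scaling by s carries the lower bounds.
The values for `uQuad` and `uTilde` then pinch, since the latter never exceeds the former. -/
theorem u_invariants_eq {F D : Type*} [Field F] [CharP F 2] (hF : DegreeOverSquaresEq F 2)
    [DivisionRing D] [Algebra F D] (hD : IsQuaternionAlgebra F D) :
    Nonempty (Involution F D) ∧
      ∀ θ : Involution F D, uPlus θ = 2 ∧ uQuad θ = 3 ∧ uTilde θ = 3 := by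
  obtain ⟨a, b, ⟨e⟩⟩ := hD.exists_algEquiv
  refine ⟨⟨canonicalInvolution e⟩, fun θ => ?_⟩
  obtain ⟨s, hs, hθ, hs'⟩ := exists_symmetric_intertwines e hD θ
  obtain ⟨hθ₂, hs₂⟩ := intertwines_symm hs hθ hs'
  have hs₁ := inv_ne_zero hs
  have hu : uQuad θ ≤ 3 :=
    (uQuad_le_of_intertwines hs hθ hs').trans (uQuad_canonicalInvolution_le e hD hF)
  have ht : 3 ≤ uTilde θ :=
    (three_le_uTilde_canonicalInvolution e).trans (uTilde_le_of_intertwines hs₁ hθ₂ hs₂)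
  have htu := uTilde_le_uQuad θ
  exact ⟨le_antisymm
    ((uPlus_le_of_intertwines hs hθ hs').trans (uPlus_canonicalInvolution_le e hD hF))
    ((two_le_uPlus_canonicalInvolution e).trans (uPlus_le_of_intertwines hs₁ hθ₂ hs₂)),
    le_antisymm hu (ht.trans htu), le_antisymm (htu.trans hu) ht⟩

end GenQuad

theorem mainTheorem6 (F : Type*) [Field F] [CharP F 2] :
    (GenQuad.DegreeOverSquaresEq F 2 →
      ∀ (Q : Type*) [DivisionRing Q] [Algebra F Q], GenQuad.IsQuaternionAlgebra F Q →
        Nonempty (GenQuad.Involution F Q) ∧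
        ∀ θ : GenQuad.Involution F Q,
          GenQuad.uPlus θ = 2 ∧ GenQuad.uQuad θ = 3 ∧ GenQuad.uTilde θ = 3) ∧
    (GenQuad.IsLocalFieldCharTwo F →
      GenQuad.DegreeOverSquaresEq F 2 ∧
      ∀ (Q : Type*) [DivisionRing Q] [Algebra F Q], GenQuad.IsQuaternionAlgebra F Q →
        Nonempty (GenQuad.Involution F Q) ∧
        ∀ θ : GenQuad.Involution F Q,
          GenQuad.uPlus θ = 2 ∧ GenQuad.uQuad θ = 3 ∧ GenQuad.uTilde θ = 3) := by
  refine ⟨fun hF Q _ _ hQ => GenQuad.u_invariants_eq hF hQ, fun hF => ?_⟩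
  have h := hF.degreeOverSquaresEq
  exact ⟨h, fun Q _ _ hQ => GenQuad.u_invariants_eq h hQ⟩
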